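/- Let $n\ge 0$ be an integer, let $\lambda$ be a partition of length $\ell(\lambda)\le n$, put $\delta=(n,n-1,\ldots,1)$, and let $\mu=\lambda+\delta$, a strict partition of length $n$. Let $\mathbf x=(x_1,\ldots,x_n)$ and $\mathbf y=(y_1,\ldots,y_n)$ be indeterminates (or, equivalently, arbitrary elements of a commutative ring). The shifted diagram $SF^\mu$ of a strict partition $\mu$ of length $n$ has the boxes $(i,j)$ (row $i$, column $j$) with $1\le i\le n$ and $i\le j\le i+\mu_i-1$. Let $\mathcal{QST}^\mu(n)$ be the set of numberings of the boxes of $SF^\mu$ by letters of the ordered alphabet $1'<1<2'<2<\cdots<n'<n$ such that the entries increase weakly along rows from left to right and down columns from top to bottom, no two equal unprimed entries lie in one column, and no two equal primed entries lie in one row. Let $\mathcal{PST}^\mu(n)$ be the set of those which have no primed entry on the main diagonal $i=j$. Let $\mathcal{QD}^\delta(n)$ be the set of numberings of $SF^\delta$ by letters of the same alphabet in which each unprimed $k$ appears only in row $k$ and each primed $k'$ only in column $k$, and $\mathcal{PD}^\delta(n)$ the set of those which have no primed entry on the main diagonal. For a numbering $T$ of any of these kinds put $(\mathbf x/\mathbf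 y)^{\mathrm{wgt}(T)}=\prod_{k=1}^n x_k^{u_k}y_k^{v_k}$, where $u_k$ and $v_k$ are the numbers of entries of $T$ equal to $k$ and to $k'$. Define $$P_\mu(\mathbf x/\mathbf y)=\sum_{T\in\mathcal{PST}^\mu(n)}(\mathbf x/\mathbf y)^{\mathrm{wgt}(T)},\qquad Q_\mu(\mathbf x/\mathbf y)=\sum_{T\in\mathcal{QST}^\mu(n)}(\mathbf x/\mathbf y)^{\mathrm{wgt}(T)},$$ and let $s_\lambda(\mathbf x)=\sum_T\mathbf x^{\mathrm{wgt}(T)}$ be the Schur function, the sum being over the semistandard tableaux $T$ of shape $\lambda$ with entries in $\{1,\ldots,n\}$, where $\mathbf x^{\mathrm{wgt}(T)}=\prod_{k=1}^n x_k^{w_k}$ and $w_k$ is the number of entries of $T$ equal to $k$. Then $$P_\mu(\mathbf x/\mathbf y)=s_\lambda(\mathbf x)\prod_{i=1}^n x_i\prod_{1\le i<j\le n}(x_i+y_j),\qquad Q_\mu(\mathbf x/\mathbf y)=s_\lambda(\mathbf x)\prod_{1\le i\le j\le n}(x_i+y_j).$$ Moreover, $$P_\mu(\mathbf x/\mathbf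 y)=\sum_{D\in\mathcal{PD}^\delta(n)}(\mathbf x/\mathbf y)^{\mathrm{wgt}(D)}\cdot s_\lambda(\mathbf x),\qquad Q_\mu(\mathbf x/\mathbf y)=\sum_{D\in\mathcal{QD}^\delta(n)}(\mathbf x/\mathbf y)^{\mathrm{wgt}(D)}\cdot s_\lambda(\mathbf x).$$ -/

import Mathlib

/-- The ordered alphabet `1' < 1 < 2' < 2 < ⋯ < n' < n`, ordered lexicographically.
The letter `(k, true)` is the unprimed letter and `(k, false)` the primed letter with index `k`;
the indices `1, …, n` are represented by `Fin n`. -/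
abbrev PrimedLetter (n : ℕ) : Type := Fin n ×ₗ Bool

namespace PrimedLetter

/-- The index of a letter: `k` for both `k` and `k'`. -/
def index {n : ℕ} (a : PrimedLetter n) : Fin n := (ofLex a).1

/-- The letter is primed. -/
def Primed {n : ℕ} (a : PrimedLetter n) : Prop := (ofLex a).2 = false

/-- The unprimed letter `k`. -/
def unprimed {n : ℕ} (k : Fin n) : PrimedLetter n := toLex (k, true)

/-- The primed letter `k'`. -/
def primed {n : ℕ} (k : Fin n) : PrimedLetter n := toLex (k, false)

end PrimedLetter

/-- A strict partition: a strictly decreasing list of positive integers. -/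
structure StrictPartition where
  parts : List ℕ
  strict : parts.SortedGT
  pos : ∀ m ∈ parts, 0 < m

namespace StrictPartition

/-- The number of parts. -/
def length (μ : StrictPartition) : ℕ := μ.parts.length

/-- The shifted Young diagram: row `i` has `μ i` boxes, starting on the main diagonal, so its
boxes are `(i, j)` (row, column) with `i ≤ j < i + μ i`; rows and columns count from `0`. -/
def shiftedDiagram (μ : StrictPartition) : Finset (ℕ × ℕ) :=
  (Finset.univ : Finset (Fin μ.parts.length)).biUnion fun i =>
    (Finset.Ico (i : ℕ) (i + μ.parts.get i)).map ⟨fun j => ((i : ℕ), j), Prod.mk_right_injective _⟩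

theorem mem_shiftedDiagram {μ : StrictPartition} {c : ℕ × ℕ} :
    c ∈ μ.shiftedDiagram ↔
      ∃ h : c.1 < μ.parts.length, c.1 ≤ c.2 ∧ c.2 < c.1 + μ.parts[c.1] := by
  obtain ⟨i, j⟩ := c
  simp only [shiftedDiagram, Finset.mem_biUnion, Finset.mem_univ, true_and, Finset.mem_map,
    Finset.mem_Ico, Function.Embedding.coeFn_mk, Prod.mk.injEq, List.get_eq_getElem]
  constructor
  · rintro ⟨k, j', h, rfl, rfl⟩
    exact ⟨k.2, h⟩
  · rintro ⟨h, h'⟩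
    exact ⟨⟨i, h⟩, j, h', rfl, rfl⟩

end StrictPartition

/-- The strict partition `λ + δ` with `δ = (n, n - 1, …, 1)`, where the partition `λ` is given by
its Young diagram; it is meant for `λ` of length at most `n`. -/
def addStaircase (lam : YoungDiagram) (n : ℕ) : StrictPartition where
  parts := List.ofFn fun i : Fin n => lam.rowLen i + (n - i)
  strict := by
    rw [List.sortedGT_ofFn_iff]
    intro i j hij
    have h := lam.rowLen_anti i j (le_of_lt hij)
    have h' : (i : ℕ) < j := hij
    have := j.2
    dsimp only
    omega
  pos := by
    intro m hm
    rw [List.mem_ofFn] at hm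
    obtain ⟨i, rfl⟩ := hm
    have := i.2
    omega

theorem length_addStaircase (lam : YoungDiagram) (n : ℕ) : (addStaircase lam n).length = n := by
  simp [addStaircase, StrictPartition.length]

/-- The staircase `δ = (n, n - 1, …, 1)`. -/
def staircase (n : ℕ) : StrictPartition := addStaircase ⊥ n

/-- All numberings of the boxes of the shifted diagram of `μ` by letters `1', 1, …, n', n`. -/
abbrev ShiftedFilling (μ : StrictPartition) (n : ℕ) : Type :=
  {c : ℕ × ℕ // c ∈ μ.shiftedDiagram} → PrimedLetter n

namespace ShiftedFilling

variable {μ : StrictPartition} {n : ℕ}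

/-- `u_k`: the number of boxes containing the unprimed letter `k`. -/
def unprimedCount (T : ShiftedFilling μ n) (k : Fin n) : ℕ :=
  (Finset.univ.filter fun c => T c = PrimedLetter.unprimed k).card

/-- `v_k`: the number of boxes containing the primed letter `k'`. -/
def primedCount (T : ShiftedFilling μ n) (k : Fin n) : ℕ :=
  (Finset.univ.filter fun c => T c = PrimedLetter.primed k).card

/-- `(x/y)^wgt(T) = x_1^{u_1} ⋯ x_n^{u_n} y_1^{v_1} ⋯ y_n^{v_n}`. -/
def monomial {R : Type*} [CommRing R] (x y : Fin n → R) (T : ShiftedFilling μ n) : R :=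
  (∏ k, x k ^ T.unprimedCount k) * ∏ k, y k ^ T.primedCount k

/-- No primed letter on the main diagonal. -/
def DiagonalUnprimed (T : ShiftedFilling μ n) : Prop :=
  ∀ c, c.1.1 = c.1.2 → ¬ (T c).Primed

end ShiftedFilling

/-- The primed shifted tableaux of shape `μ` in the letters `1', 1, …, n', n`, with primes allowed
on the main diagonal. -/
structure IsQST {μ : StrictPartition} {n : ℕ} (T : ShiftedFilling μ n) : Prop where
  row_weak : ∀ c d, c.1.1 = d.1.1 → c.1.2 ≤ d.1.2 → T c ≤ T d
  col_weak : ∀ c d, c.1.2 = d.1.2 → c.1.1 ≤ d.1.1 → T c ≤ T d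
  col_unprimed : ∀ c d, c.1.2 = d.1.2 → c ≠ d → T c = T d → (T c).Primed
  row_primed : ∀ c d, c.1.1 = d.1.1 → c ≠ d → T c = T d → ¬ (T c).Primed

/-- The primed shifted tableaux of shape `μ` without primes on the main diagonal. -/
structure IsPST {μ : StrictPartition} {n : ℕ} (T : ShiftedFilling μ n) : Prop extends IsQST T where
  diagonal : T.DiagonalUnprimed

/-- Numberings of the staircase diagram in which `k` occurs only in row `k` and `k'` only in
column `k`. -/
structure IsQD {n : ℕ} (T : ShiftedFilling (staircase n) n) : Prop where
  unprimed_row : ∀ c, ¬ (T c).Primed → c.1.1 = (T c).index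
  primed_col : ∀ c, (T c).Primed → c.1.2 = (T c).index

/-- Such numberings of the staircase diagram without primes on the main diagonal. -/
structure IsPD {n : ℕ} (T : ShiftedFilling (staircase n) n) : Prop extends IsQD T where
  diagonal : T.DiagonalUnprimed

open Classical in
/-- The sum of `(x/y)^wgt(T)` over all numberings `T` with the property `S`. -/
noncomputable def shiftedSum {R : Type*} [CommRing R] {μ : StrictPartition} {n : ℕ}
    (S : ShiftedFilling μ n → Prop) (x y : Fin n → R) : R :=
  ∑ T ∈ Finset.univ.filter S, T.monomial x y

/-- The generalised Schur `P`-function `P_μ(x/y)`. -/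
noncomputable def schurP {R : Type*} [CommRing R] {n : ℕ} (μ : StrictPartition)
    (x y : Fin n → R) : R :=
  shiftedSum (μ := μ) IsPST x y

/-- The generalised Schur `Q`-function `Q_μ(x/y)`. -/
noncomputable def schurQ {R : Type*} [CommRing R] {n : ℕ} (μ : StrictPartition)
    (x y : Fin n → R) : R :=
  shiftedSum (μ := μ) IsQST x y

/-- The semistandard tableaux of shape `lam` with entries in an `n`-element alphabet
(represented by `0 < 1 < ⋯ < n - 1`). -/
abbrev BoundedSSYT (lam : YoungDiagram) (n : ℕ) : Type :=
  {T : SemistandardYoungTableau lam // ∀ c ∈ lam, T c.1 c.2 < n}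

instance instFiniteBoundedSSYT (lam : YoungDiagram) (n : ℕ) : Finite (BoundedSSYT lam n) := by
  refine Finite.of_injective
    (fun (T : BoundedSSYT lam n) (c : {c : ℕ × ℕ // c ∈ lam.cells}) =>
      (⟨T.1 c.1.1 c.1.2, T.2 c.1 ((YoungDiagram.mem_cells _).1 c.2)⟩ : Fin n)) ?_
  intro T T' h
  apply Subtype.ext
  ext i j
  by_cases hc : (i, j) ∈ lam
  · exact congrArg Fin.val (congrFun h ⟨(i, j), (YoungDiagram.mem_cells _).2 hc⟩)
  · rw [T.1.zeros hc, T'.1.zeros hc]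

noncomputable instance instFintypeBoundedSSYT (lam : YoungDiagram) (n : ℕ) :
    Fintype (BoundedSSYT lam n) := Fintype.ofFinite _

/-- `w_k`: the number of boxes containing `k`. -/
def BoundedSSYT.count {lam : YoungDiagram} {n : ℕ} (T : BoundedSSYT lam n) (k : Fin n) : ℕ :=
  (lam.cells.filter fun c => T.1 c.1 c.2 = k).card

/-- The Schur function `s_λ(x_1, …, x_n)`, the sum of `x^wgt(T)` over semistandard tableaux. -/
noncomputable def schurS {R : Type*} [CommRing R] {n : ℕ} (lam : YoungDiagram)
    (x : Fin n → R) : R :=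
  ∑ T : BoundedSSYT lam n, ∏ k, x k ^ T.count k

/-!
Multiplied by the Vandermonde product `∏_{i<j} (x_i - x_j)`, both the Schur function and the
generating functions of primed shifted tableaux become multiples of the alternant
`det (x_j ^ (λ_i + n - i))` (rows counted from `1`). For indeterminates over `ℤ` the product can be
cancelled, which gives the factorisation, and then it holds in every commutative ring by
specialisation (`tableauSum_shiftedStrip_eq`).

The alternant formulas are proved by induction on `n`, removing the letters with the largest index.
All kinds of tableaux are treated as fillings of a set of boxes by natural numbers, increasing along
rows and columns, in which the boxes with a given entry form a horizontal or vertical strip; the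
letters `k'` and `k` become consecutive numbers. In the induction step the variables are
`x_0, …, x_n`. Removing the largest entry leaves a filling of the
same kind on a smaller set of boxes (`tableauSum_succ`).

* Removing a horizontal strip makes the row ends interlace (`tableauSum_succ_of_horizontal`). Row
  operations on an alternant in `n + 1` variables produce the same sum over interlacing exponents
  (`alternant_succ`, `sum_interlacing_alternant`). For semistandard tableaux this proves the
  bialternant formula `tableauSum_ssytStrip_mul`.
* Removing a vertical strip lowers the row ends by `0` or `1` independently
  (`tableauSum_succ_of_vertical`). As the determinant is multilinear, summing the alternants over all
  choices multiplies the column of `x_j` by `x_j + y_n`; choices that do not give a shifted diagram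
  contribute alternants with two equal rows (`tableauSum_shiftedStrip_odd_mul`).

Along the main diagonal of a primed shifted tableau the indices increase strictly, so a tableau of
length `n` has precisely one diagonal box for each index. The one for `n` contributes `x_n`, or
`x_n + y_n` if primes are allowed there (`tableauSum_shiftedStrip_mul`).

The numberings of the staircase expand the product of the `x_i + y_j` box by box
(`shiftedSum_staircase`).
-/

/-! ### Tableaux as chains of strips -/

/-- The boxes of `D` whose entry in the filling `T` is `a`. -/
def fillingFiber {N : ℕ} {D : Finset (ℕ × ℕ)} (T : {c // c ∈ D} → Fin N) (a : Fin N) :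
    Finset (ℕ × ℕ) :=
  (Finset.univ.filter fun c => T c = a).map (Function.Embedding.subtype _)

theorem mem_fillingFiber {N : ℕ} {D : Finset (ℕ × ℕ)} {T : {c // c ∈ D} → Fin N} {a : Fin N}
    {c : ℕ × ℕ} : c ∈ fillingFiber T a ↔ ∃ h : c ∈ D, T ⟨c, h⟩ = a := by
  simp [fillingFiber]

/-- A filling of an arbitrary finite set `D` of boxes that increases weakly along rows and down
columns, and in which the set of boxes with entry `a` satisfies the condition `H a`. -/
structure IsStripTableau (H : ℕ → Finset (ℕ × ℕ) → Prop) {N : ℕ} {D : Finset (ℕ × ℕ)}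
    (T : {c // c ∈ D} → Fin N) : Prop where
  row_weak : ∀ c d, c.1.1 = d.1.1 → c.1.2 ≤ d.1.2 → T c ≤ T d
  col_weak : ∀ c d, c.1.2 = d.1.2 → c.1.1 ≤ d.1.1 → T c ≤ T d
  strip : ∀ a : Fin N, H a (fillingFiber T a)

open Classical in
/-- The generating function of the strip tableaux on `D` with entries `0, …, N - 1`, where an
entry `a` has weight `w a`. -/
noncomputable def tableauSum {R : Type*} [CommRing R] (H : ℕ → Finset (ℕ × ℕ) → Prop) (w : ℕ → R)
    (N : ℕ) (D : Finset (ℕ × ℕ)) : R :=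
  ∑ T : {c // c ∈ D} → Fin N with IsStripTableau H T, ∏ c, w (T c)

/-- `E` contains, with each of its boxes, all boxes of `D` to the left in the same row and above in
the same column. -/
structure IsLowerIn (E D : Finset (ℕ × ℕ)) : Prop where
  subset : E ⊆ D
  row : ∀ c ∈ D, ∀ d ∈ E, c.1 = d.1 → c.2 ≤ d.2 → c ∈ E
  col : ∀ c ∈ D, ∀ d ∈ E, c.2 = d.2 → c.1 ≤ d.1 → c ∈ E

theorem tableauSum_empty {R : Type*} [CommRing R] (H : ℕ → Finset (ℕ × ℕ) → Prop) (w : ℕ → R) :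
    tableauSum H w 0 ∅ = 1 := by
  classical
  have : ∀ T : {c // c ∈ (∅ : Finset (ℕ × ℕ))} → Fin 0, IsStripTableau H T := fun T =>
    ⟨fun c => (Finset.notMem_empty _ c.2).elim, fun c => (Finset.notMem_empty _ c.2).elim,
      fun a => a.elim0⟩
  simp [tableauSum, this]

theorem tableauSum_zero_of_nonempty {R : Type*} [CommRing R] (H : ℕ → Finset (ℕ × ℕ) → Prop)
    (w : ℕ → R) {D : Finset (ℕ × ℕ)} (hD : D.Nonempty) : tableauSum H w 0 D = 0 := by
  obtain ⟨c, hc⟩ := hD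
  have : IsEmpty ({c // c ∈ D} → Fin 0) := ⟨fun T => (T ⟨c, hc⟩).elim0⟩
  simp [tableauSum]

theorem map_tableauSum {R S : Type*} [CommRing R] [CommRing S] (f : R →+* S)
    (H : ℕ → Finset (ℕ × ℕ) → Prop) (w : ℕ → R) (N : ℕ) (D : Finset (ℕ × ℕ)) :
    f (tableauSum H w N D) = tableauSum H (fun a => f (w a)) N D := by
  simp [tableauSum, map_sum, map_prod]

/-- The filling of `D` that agrees with `T` on `E` and has the new largest entry elsewhere. -/
def extendByLast {N : ℕ} {D E : Finset (ℕ × ℕ)} (T : {c // c ∈ E} → Fin N) :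
    {c // c ∈ D} → Fin (N + 1) :=
  fun c => if h : c.1 ∈ E then (T ⟨c.1, h⟩).castSucc else Fin.last N

theorem extendByLast_of_mem {N : ℕ} {D E : Finset (ℕ × ℕ)} (T : {c // c ∈ E} → Fin N)
    {c : {c // c ∈ D}} (h : c.1 ∈ E) : extendByLast T c = (T ⟨c.1, h⟩).castSucc := by
  simp [extendByLast, h]

theorem extendByLast_of_notMem {N : ℕ} {D E : Finset (ℕ × ℕ)} (T : {c // c ∈ E} → Fin N)
    {c : {c // c ∈ D}} (h : c.1 ∉ E) : extendByLast T c = Fin.last N := by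
  simp [extendByLast, h]

theorem fillingFiber_extendByLast_last {N : ℕ} {D E : Finset (ℕ × ℕ)}
    (T : {c // c ∈ E} → Fin N) :
    fillingFiber (extendByLast T : {c // c ∈ D} → _) (Fin.last N) = D \ E := by
  ext c
  simp only [mem_fillingFiber, Finset.mem_sdiff]
  constructor
  · rintro ⟨h, h'⟩
    refine ⟨h, fun hE => ?_⟩
    rw [extendByLast_of_mem T (c := ⟨c, h⟩) hE] at h'
    exact (Fin.castSucc_lt_last _).ne h'
  · rintro ⟨h, h'⟩
    exact ⟨h, extendByLast_of_notMem T h'⟩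

theorem fillingFiber_extendByLast_castSucc {N : ℕ} {D E : Finset (ℕ × ℕ)} (hED : E ⊆ D)
    (T : {c // c ∈ E} → Fin N) (a : Fin N) :
    fillingFiber (extendByLast T : {c // c ∈ D} → _) a.castSucc = fillingFiber T a := by
  ext c
  simp only [mem_fillingFiber]
  constructor
  · rintro ⟨h, h'⟩
    by_cases hE : c ∈ E
    · rw [extendByLast_of_mem T (c := ⟨c, h⟩) hE] at h'
      exact ⟨hE, Fin.castSucc_injective _ h'⟩
    · rw [extendByLast_of_notMem T (c := ⟨c, h⟩) hE] at h'
      exact ((Fin.castSucc_lt_last _).ne h'.symm).elim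
  · rintro ⟨h, h'⟩
    exact ⟨hED h, by rw [extendByLast_of_mem T (c := ⟨c, hED h⟩) h, h']⟩

theorem isStripTableau_extendByLast {H : ℕ → Finset (ℕ × ℕ) → Prop} {N : ℕ}
    {D E : Finset (ℕ × ℕ)} (hED : E ⊆ D) (T : {c // c ∈ E} → Fin N) :
    IsStripTableau H (extendByLast T : {c // c ∈ D} → _) ↔
      IsStripTableau H T ∧ IsLowerIn E D ∧ H N (D \ E) := by
  have hle : ∀ (c d : {c // c ∈ D}), (d.1 ∈ E → c.1 ∈ E) →
      (∀ (hc : c.1 ∈ E) (hd : d.1 ∈ E), T ⟨c.1, hc⟩ ≤ T ⟨d.1, hd⟩) →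
      (extendByLast T c) ≤ (extendByLast T d) := by
    intro c d h1 h2
    by_cases hd : d.1 ∈ E
    · rw [extendByLast_of_mem T (h1 hd), extendByLast_of_mem T hd]
      exact Fin.castSucc_le_castSucc_iff.2 (h2 _ _)
    · rw [extendByLast_of_notMem T hd]
      exact Fin.le_last _
  have hmem : ∀ (c d : {c // c ∈ D}), (extendByLast T c) ≤ (extendByLast T d) →
      d.1 ∈ E → c.1 ∈ E := by
    intro c d h hd
    by_contra hc
    rw [extendByLast_of_notMem T hc, extendByLast_of_mem T hd] at h
    exact absurd h (not_le.2 (Fin.castSucc_lt_last _))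
  have hval : ∀ (c d : {c // c ∈ E}), (extendByLast T (⟨c.1, hED c.2⟩ : {c // c ∈ D})) ≤
      (extendByLast T (⟨d.1, hED d.2⟩ : {c // c ∈ D})) → T c ≤ T d := by
    intro c d h
    rw [extendByLast_of_mem T (c := ⟨c.1, hED c.2⟩) c.2,
      extendByLast_of_mem T (c := ⟨d.1, hED d.2⟩) d.2] at h
    exact Fin.castSucc_le_castSucc_iff.1 h
  constructor
  · intro h
    refine ⟨⟨fun c d h1 h2 => hval c d (h.row_weak _ _ h1 h2),
      fun c d h1 h2 => hval c d (h.col_weak _ _ h1 h2), fun a => ?_⟩, ⟨hED, ?_, ?_⟩, ?_⟩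
    · have := h.strip a.castSucc
      rwa [fillingFiber_extendByLast_castSucc hED] at this
    · exact fun c hc d hd h1 h2 => hmem ⟨c, hc⟩ ⟨d, hED hd⟩ (h.row_weak _ _ h1 h2) hd
    · exact fun c hc d hd h1 h2 => hmem ⟨c, hc⟩ ⟨d, hED hd⟩ (h.col_weak _ _ h1 h2) hd
    · have := h.strip (Fin.last N)
      rwa [fillingFiber_extendByLast_last] at this
  · rintro ⟨hT, hE, hH⟩
    refine ⟨fun c d h1 h2 => hle c d (fun hd => hE.row _ c.2 _ hd h1 h2)
        fun hc hd => hT.row_weak _ _ h1 h2,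
      fun c d h1 h2 => hle c d (fun hd => hE.col _ c.2 _ hd h1 h2)
        fun hc hd => hT.col_weak _ _ h1 h2, fun a => ?_⟩
    induction a using Fin.lastCases with
    | last => rwa [fillingFiber_extendByLast_last]
    | cast a => rw [fillingFiber_extendByLast_castSucc hED]; exact hT.strip a

theorem prod_extendByLast {R : Type*} [CommRing R] (w : ℕ → R) {N : ℕ} {D E : Finset (ℕ × ℕ)}
    (hED : E ⊆ D) (T : {c // c ∈ E} → Fin N) :
    ∏ c : {c // c ∈ D}, w (extendByLast T c) = w N ^ (D \ E).card * ∏ c, w (T c) := by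
  classical
  let g : ℕ × ℕ → R := fun c => if h : c ∈ E then w (T ⟨c, h⟩) else w N
  have h1 : ∀ c : {c // c ∈ D}, w (extendByLast T c) = g c.1 := by
    intro c
    by_cases h : c.1 ∈ E
    · simp [g, h, extendByLast_of_mem T h]
    · simp [g, h, extendByLast_of_notMem T h]
  have h2 : ∀ c : {c // c ∈ E}, w (T c) = g c.1 := fun c => by simp [g, c.2]
  simp_rw [h1, h2]
  rw [Finset.prod_coe_sort D g, Finset.prod_coe_sort E g, ← Finset.prod_sdiff hED]
  congr 1
  rw [← Finset.prod_const]
  exact Finset.prod_congr rfl fun c hc => by simp [g, (Finset.mem_sdiff.1 hc).2]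

open Classical in
/-- Branching: a strip tableau is determined by the boxes that do not contain the largest entry and
by its restriction to them. -/
theorem tableauSum_succ {R : Type*} [CommRing R] (H : ℕ → Finset (ℕ × ℕ) → Prop) (w : ℕ → R)
    (N : ℕ) (D : Finset (ℕ × ℕ)) :
    tableauSum H w (N + 1) D =
      ∑ E ∈ D.powerset with IsLowerIn E D ∧ H N (D \ E),
        w N ^ (D \ E).card * tableauSum H w N E := by
  have key : ∀ E ∈ D.powerset,
      ∑ T : {c // c ∈ D} → Fin (N + 1) with
          IsStripTableau H T ∧ D \ fillingFiber T (Fin.last N) = E, ∏ c, w (T c) =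
        if IsLowerIn E D ∧ H N (D \ E) then w N ^ (D \ E).card * tableauSum H w N E else 0 := by
    intro E hE
    rw [Finset.mem_powerset] at hE
    have hfib : ∀ T : {c // c ∈ E} → Fin N,
        D \ fillingFiber (extendByLast T : {c // c ∈ D} → _) (Fin.last N) = E := by
      intro T
      rw [fillingFiber_extendByLast_last, Finset.sdiff_sdiff_eq_self hE]
    have hsurj : ∀ T : {c // c ∈ D} → Fin (N + 1), D \ fillingFiber T (Fin.last N) = E →
        ∃ T' : {c // c ∈ E} → Fin N, extendByLast T' = T := by
      intro T hT
      have hne : ∀ c : {c // c ∈ E}, T ⟨c.1, hE c.2⟩ ≠ Fin.last N := by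
        intro c hc
        have := (Finset.ext_iff.1 hT c.1).2 c.2
        exact (Finset.mem_sdiff.1 this).2 (mem_fillingFiber.2 ⟨hE c.2, hc⟩)
      refine ⟨fun c => (T ⟨c.1, hE c.2⟩).castPred (hne c), funext fun c => ?_⟩
      by_cases h : c.1 ∈ E
      · rw [extendByLast_of_mem _ h, Fin.castSucc_castPred]
      · rw [extendByLast_of_notMem _ h]
        rw [← hT, Finset.mem_sdiff, not_and_not_right] at h
        obtain ⟨_, h'⟩ := mem_fillingFiber.1 (h c.2)
        exact h'.symm
    split_ifs with hcond
    · rw [tableauSum, Finset.mul_sum]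
      symm
      refine Finset.sum_bij (fun T _ => extendByLast T) ?_ ?_ ?_ ?_
      · intro T hT
        rw [Finset.mem_filter] at hT
        simp only [Finset.mem_filter, Finset.mem_univ, true_and]
        exact ⟨(isStripTableau_extendByLast hE T).2 ⟨hT.2, hcond⟩, hfib T⟩
      · intro T _ T' _ h
        funext c
        have := congrFun h ⟨c.1, hE c.2⟩
        rw [extendByLast_of_mem T (c := ⟨c.1, hE c.2⟩) c.2,
          extendByLast_of_mem T' (c := ⟨c.1, hE c.2⟩) c.2] at this
        exact Fin.castSucc_injective _ this
      · intro T hT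
        simp only [Finset.mem_filter, Finset.mem_univ, true_and] at hT
        obtain ⟨T', rfl⟩ := hsurj T hT.2
        refine ⟨T', ?_, rfl⟩
        simp only [Finset.mem_filter, Finset.mem_univ, true_and]
        exact ((isStripTableau_extendByLast hE T').1 hT.1).1
      · intro T _
        exact (prod_extendByLast w hE T).symm
    · refine Finset.sum_eq_zero fun T hT => ?_
      simp only [Finset.mem_filter, Finset.mem_univ, true_and] at hT
      obtain ⟨T', rfl⟩ := hsurj T hT.2
      exact (hcond ((isStripTableau_extendByLast hE T').1 hT.1).2).elim
  rw [Finset.sum_filter, ← Finset.sum_congr rfl key, tableauSum]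
  rw [← Finset.sum_fiberwise_of_maps_to (s := Finset.univ.filter _) (t := D.powerset)
    (g := fun T => D \ fillingFiber T (Fin.last N))
    fun T _ => Finset.mem_powerset.2 Finset.sdiff_subset]
  exact Finset.sum_congr rfl fun E _ => by rw [Finset.filter_filter]

/-! ### Diagrams given by the ends of their rows -/

/-- The set of boxes `(i, j)` with `s i ≤ j < e i`, where `i` runs over `m` rows. -/
def rowDiagram {m : ℕ} (s e : Fin m → ℕ) : Finset (ℕ × ℕ) :=
  Finset.univ.biUnion fun i =>
    (Finset.Ico (s i) (e i)).map ⟨fun j => ((i : ℕ), j), Prod.mk_right_injective _⟩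

theorem mem_rowDiagram {m : ℕ} {s e : Fin m → ℕ} {c : ℕ × ℕ} :
    c ∈ rowDiagram s e ↔ ∃ h : c.1 < m, s ⟨c.1, h⟩ ≤ c.2 ∧ c.2 < e ⟨c.1, h⟩ := by
  obtain ⟨i, j⟩ := c
  simp only [rowDiagram, Finset.mem_biUnion, Finset.mem_univ, true_and, Finset.mem_map,
    Finset.mem_Ico, Function.Embedding.coeFn_mk, Prod.mk.injEq]
  constructor
  · rintro ⟨k, j', h, rfl, rfl⟩
    exact ⟨k.2, h⟩
  · rintro ⟨h, h'⟩
    exact ⟨⟨i, h⟩, j, h', rfl, rfl⟩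

theorem mk_mem_rowDiagram {m : ℕ} {s e : Fin m → ℕ} {i : Fin m} {j : ℕ} :
    ((i : ℕ), j) ∈ rowDiagram s e ↔ s i ≤ j ∧ j < e i := by
  simp [mem_rowDiagram]

theorem card_rowDiagram {m : ℕ} (s e : Fin m → ℕ) :
    (rowDiagram s e).card = ∑ i, (e i - s i) := by
  rw [rowDiagram, Finset.card_biUnion]
  · simp
  · intro i _ k _ hik
    rw [Function.onFun, Finset.disjoint_left]
    intro c hc hc'
    simp only [Finset.mem_map, Function.Embedding.coeFn_mk] at hc hc'
    obtain ⟨j, _, rfl⟩ := hc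
    obtain ⟨j', _, h⟩ := hc'
    exact hik (Fin.ext (Prod.mk.inj h).1.symm)

theorem rowDiagram_sdiff {m : ℕ} {s e e' : Fin m → ℕ} (h : ∀ i, s i ≤ e' i) :
    rowDiagram s e \ rowDiagram s e' = rowDiagram e' e := by
  ext c
  simp only [Finset.mem_sdiff, mem_rowDiagram]
  constructor
  · rintro ⟨⟨hc, h1, h2⟩, h3⟩
    exact ⟨hc, not_lt.1 fun h4 => h3 ⟨hc, h1, h4⟩, h2⟩
  · rintro ⟨hc, h1, h2⟩
    exact ⟨⟨hc, (h _).trans h1, h2⟩, fun ⟨_, _, h3⟩ => absurd h3 (not_lt.2 h1)⟩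

theorem rowDiagram_snoc {m : ℕ} (s : Fin (m + 1) → ℕ) (e : Fin m → ℕ) :
    rowDiagram s (Fin.snoc (α := fun _ => ℕ) e (s (Fin.last m))) =
      rowDiagram (fun i => s i.castSucc) e := by
  ext ⟨i, j⟩
  constructor
  · intro h
    obtain ⟨hi, -⟩ := mem_rowDiagram.1 h
    obtain ⟨i, rfl⟩ : ∃ k : Fin (m + 1), (k : ℕ) = i := ⟨⟨i, hi⟩, rfl⟩
    rw [mk_mem_rowDiagram] at h
    induction i using Fin.lastCases with
    | last => rw [Fin.snoc_last] at h; omega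
    | cast i =>
      rw [Fin.snoc_castSucc] at h
      exact (mk_mem_rowDiagram (i := i)).2 h
  · intro h
    obtain ⟨hi, -⟩ := mem_rowDiagram.1 h
    obtain ⟨i, rfl⟩ : ∃ k : Fin m, (k : ℕ) = i := ⟨⟨i, hi⟩, rfl⟩
    rw [mk_mem_rowDiagram] at h
    refine (mk_mem_rowDiagram (i := i.castSucc)).2 ?_
    rwa [Fin.snoc_castSucc]

theorem rowDiagram_injective {m : ℕ} {s e e' : Fin m → ℕ} (he : ∀ i, s i ≤ e i)
    (he' : ∀ i, s i ≤ e' i) (h : rowDiagram s e = rowDiagram s e') : e = e' := by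
  have key : ∀ {e e' : Fin m → ℕ}, (∀ i, s i ≤ e' i) →
      rowDiagram s e = rowDiagram s e' → ∀ i, e i ≤ e' i := by
    intro e e' he' h i
    by_contra! hlt
    have h1 : ((i : ℕ), e' i) ∈ rowDiagram s e := mk_mem_rowDiagram.2 ⟨he' i, hlt⟩
    rw [h, mk_mem_rowDiagram] at h1
    exact lt_irrefl _ h1.2
  exact funext fun i => le_antisymm (key he' h i) (key he h.symm i)

theorem exists_rowDiagram_of_isLowerIn {m : ℕ} {s e : Fin m → ℕ} {E : Finset (ℕ × ℕ)}
    (hse : ∀ i, s i ≤ e i) (hE : IsLowerIn E (rowDiagram s e)) :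
    ∃ e' : Fin m → ℕ, (∀ i, s i ≤ e' i) ∧ (∀ i, e' i ≤ e i) ∧ E = rowDiagram s e' := by
  -- The row `i` of `E` ends at the first box to the right of its start that is missing in `E`.
  have hex : ∀ i : Fin m, ∃ j, s i ≤ j ∧ ((i : ℕ), j) ∉ E := fun i =>
    ⟨e i, hse i, fun h => lt_irrefl _ (mk_mem_rowDiagram.1 (hE.subset h)).2⟩
  classical
  refine ⟨fun i => Nat.find (hex i), fun i => (Nat.find_spec (hex i)).1, fun i => ?_, ?_⟩
  · exact Nat.find_min' _ ⟨hse i, fun h => lt_irrefl _ (mk_mem_rowDiagram.1 (hE.subset h)).2⟩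
  · ext ⟨i, j⟩
    constructor
    · intro h
      obtain ⟨hi, h1, h2⟩ := mem_rowDiagram.1 (hE.subset h)
      obtain ⟨i, rfl⟩ : ∃ k : Fin m, (k : ℕ) = i := ⟨⟨i, hi⟩, rfl⟩
      refine mk_mem_rowDiagram.2 ⟨h1, ?_⟩
      by_contra! hle
      have hspec := Nat.find_spec (hex i)
      exact hspec.2 (hE.row _ (mk_mem_rowDiagram.2 ⟨hspec.1, hle.trans_lt h2⟩) _ h rfl hle)
    · intro h
      obtain ⟨hi, -⟩ := mem_rowDiagram.1 h
      obtain ⟨i, rfl⟩ : ∃ k : Fin m, (k : ℕ) = i := ⟨⟨i, hi⟩, rfl⟩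
      obtain ⟨h1, h2⟩ := mk_mem_rowDiagram.1 h
      have := Nat.find_min (hex i) h2
      rw [not_and_not_right] at this
      exact this h1

theorem isLowerIn_rowDiagram_iff {m : ℕ} {s e e' : Fin m → ℕ} (hs : Monotone s)
    (he : Antitone e) (he'e : ∀ i, e' i ≤ e i) :
    IsLowerIn (rowDiagram s e') (rowDiagram s e) ↔
      ∀ i k, i < k → s k < e' k → e' k ≤ e' i := by
  constructor
  · intro h i k hik hk
    by_contra! hlt
    have h1 : ((k : ℕ), e' k - 1) ∈ rowDiagram s e' := mk_mem_rowDiagram.2 (by omega)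
    have h2 : ((i : ℕ), e' k - 1) ∈ rowDiagram s e := by
      have := hs hik.le
      have := he hik.le
      have := he'e k
      exact mk_mem_rowDiagram.2 (by omega)
    have h3 := mk_mem_rowDiagram.1 (h.col _ h2 _ h1 rfl hik.le)
    omega
  · intro h
    refine ⟨?_, ?_, ?_⟩
    · intro c hc
      obtain ⟨hi, h1, h2⟩ := mem_rowDiagram.1 hc
      exact mem_rowDiagram.2 ⟨hi, h1, h2.trans_le (he'e _)⟩
    · rintro ⟨i, j⟩ hc ⟨i', j'⟩ hd h1 h2
      obtain ⟨hi, h3, h4⟩ := mem_rowDiagram.1 hc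
      obtain ⟨hi', h5, h6⟩ := mem_rowDiagram.1 hd
      dsimp only at *
      subst h1
      exact mem_rowDiagram.2 ⟨hi, h3, h2.trans_lt h6⟩
    · rintro ⟨i, j⟩ hc ⟨i', j'⟩ hd h1 h2
      obtain ⟨hi, h3, h4⟩ := mem_rowDiagram.1 hc
      obtain ⟨hi', h5, h6⟩ := mem_rowDiagram.1 hd
      dsimp only at *
      subst h1
      rcases h2.eq_or_lt with rfl | hlt
      · exact hd
      · exact mem_rowDiagram.2 ⟨hi, h3, h6.trans_le (h ⟨i, hi⟩ ⟨i', hi'⟩ hlt (h5.trans_lt h6))⟩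

/-- At most one box in each column. -/
def IsHorizontalStrip (A : Finset (ℕ × ℕ)) : Prop :=
  ∀ c ∈ A, ∀ d ∈ A, c.2 = d.2 → c = d

/-- At most one box in each row. -/
def IsVerticalStrip (A : Finset (ℕ × ℕ)) : Prop :=
  ∀ c ∈ A, ∀ d ∈ A, c.1 = d.1 → c = d

theorem isVerticalStrip_rowDiagram_iff {m : ℕ} {s e : Fin m → ℕ} :
    IsVerticalStrip (rowDiagram s e) ↔ ∀ i, e i ≤ s i + 1 := by
  constructor
  · intro h i
    by_contra! hlt
    have := h _ (mk_mem_rowDiagram (i := i) (j := s i).2 ⟨le_rfl, by omega⟩) _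
      (mk_mem_rowDiagram (i := i) (j := s i + 1).2 ⟨by omega, hlt⟩) rfl
    simp at this
  · rintro h ⟨i, j⟩ hc ⟨i', j'⟩ hd h1
    dsimp only at h1
    subst h1
    obtain ⟨hi, h3, h4⟩ := mem_rowDiagram.1 hc
    obtain ⟨hi', h5, h6⟩ := mem_rowDiagram.1 hd
    have := h ⟨i, hi⟩
    dsimp only at *
    rw [Prod.mk.injEq]
    omega

/-- Row lengths interlace: the lower sets whose complement is a horizontal strip. -/
theorem isLowerIn_and_isHorizontalStrip_iff {m : ℕ} {s e e' : Fin (m + 1) → ℕ} (hs : Monotone s)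
    (he : Antitone e) (hse' : ∀ i, s i ≤ e' i) (he'e : ∀ i, e' i ≤ e i)
    (hne : ∀ i : Fin m, e i.succ ≤ s i.castSucc ∨ s i.succ < e i.succ) :
    (IsLowerIn (rowDiagram s e') (rowDiagram s e) ∧
      IsHorizontalStrip (rowDiagram s e \ rowDiagram s e')) ↔
      ∀ i : Fin m, e i.succ ≤ e' i.castSucc := by
  rw [rowDiagram_sdiff hse']
  constructor
  · rintro ⟨h1, h2⟩ i
    rcases hne i with h | h
    · exact h.trans (hse' _)
    by_contra! hlt
    have h3 : ((i.succ : ℕ), e i.succ - 1) ∈ rowDiagram s e := mk_mem_rowDiagram.2 (by omega)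
    have hee := he (Fin.castSucc_lt_succ (i := i)).le
    have h4 : ((i.castSucc : ℕ), e i.succ - 1) ∈ rowDiagram e' e :=
      mk_mem_rowDiagram.2 (by omega)
    by_cases h5 : e' i.succ ≤ e i.succ - 1
    · have := h2 _ (mk_mem_rowDiagram.2 ⟨h5, by omega⟩) _ h4 rfl
      simp at this
    · have h6 := (isLowerIn_rowDiagram_iff hs he he'e).1 h1 i.castSucc i.succ
        (Fin.castSucc_lt_succ (i := i))
      omega
  · intro h
    have h' : ∀ i k : Fin (m + 1), i < k → e k ≤ e' i := by
      intro i k hik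
      have hi : (i : ℕ) < m := lt_of_lt_of_le (Fin.lt_def.1 hik) (Nat.le_of_lt_succ k.2)
      have := h ⟨i, hi⟩
      refine le_trans (he ?_) this
      exact Fin.le_def.2 (Nat.succ_le_of_lt (Fin.lt_def.1 hik))
    refine ⟨(isLowerIn_rowDiagram_iff hs he he'e).2 fun i k hik _ =>
      (he'e k).trans (h' i k hik), ?_⟩
    rintro ⟨i, j⟩ hc ⟨i', j'⟩ hd h1
    dsimp only at h1
    subst h1
    obtain ⟨hi, h3, h4⟩ := mem_rowDiagram.1 hc
    obtain ⟨hi', h5, h6⟩ := mem_rowDiagram.1 hd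
    dsimp only at *
    rcases lt_trichotomy i i' with hlt | rfl | hlt
    · have := h' ⟨i, hi⟩ ⟨i', hi'⟩ hlt
      omega
    · rfl
    · have := h' ⟨i', hi'⟩ ⟨i, hi⟩ hlt
      omega

/-- Branching over a horizontal strip: the ends of the remaining rows interlace with the ends
of the given rows. -/
theorem tableauSum_succ_of_horizontal {R : Type*} [CommRing R]
    {H : ℕ → Finset (ℕ × ℕ) → Prop} {w : ℕ → R} {N : ℕ} (hH : ∀ A, H N A ↔ IsHorizontalStrip A)
    {m : ℕ} {s e : Fin (m + 1) → ℕ} (hs : Monotone s) (he : Antitone e) (hse : ∀ i, s i ≤ e i)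
    (hne : ∀ i : Fin m, e i.succ ≤ s i.castSucc ∨ s i.succ < e i.succ) :
    tableauSum H w (N + 1) (rowDiagram s e) =
      ∑ e' ∈ Fintype.piFinset fun i => Finset.Icc
          (Fin.snoc (α := fun _ => ℕ) (fun i : Fin m => e i.succ) (s (Fin.last m)) i) (e i),
        (∏ i, w N ^ (e i - e' i)) * tableauSum H w N (rowDiagram s e') := by
  classical
  rw [tableauSum_succ]
  have hlo : ∀ i, s i ≤
      Fin.snoc (α := fun _ => ℕ) (fun i : Fin m => e i.succ) (s (Fin.last m)) i := by
    intro i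
    induction i using Fin.lastCases with
    | last => rw [Fin.snoc_last]
    | cast i =>
      rw [Fin.snoc_castSucc]
      exact (hs (Fin.castSucc_lt_succ (i := i)).le).trans (hse _)
  have hbd : ∀ {e' : Fin (m + 1) → ℕ}, e' ∈ Fintype.piFinset (fun i => Finset.Icc
      (Fin.snoc (α := fun _ => ℕ) (fun i : Fin m => e i.succ) (s (Fin.last m)) i) (e i)) ↔
      (∀ i, s i ≤ e' i) ∧ (∀ i, e' i ≤ e i) ∧ ∀ i : Fin m, e i.succ ≤ e' i.castSucc := by
    intro e'
    simp only [Fintype.mem_piFinset, Finset.mem_Icc]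
    constructor
    · intro h
      refine ⟨fun i => (hlo i).trans (h i).1, fun i => (h i).2, fun i => ?_⟩
      have := (h i.castSucc).1
      rwa [Fin.snoc_castSucc] at this
    · rintro ⟨h1, h2, h3⟩ i
      refine ⟨?_, h2 i⟩
      induction i using Fin.lastCases with
      | last => rw [Fin.snoc_last]; exact h1 _
      | cast i => rw [Fin.snoc_castSucc]; exact h3 i
  symm
  refine Finset.sum_bij (fun e' _ => rowDiagram s e') ?_ ?_ ?_ ?_
  · intro e' he'
    obtain ⟨h1, h2, h3⟩ := hbd.1 he'
    have := (isLowerIn_and_isHorizontalStrip_iff hs he h1 h2 hne).2 h3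
    exact Finset.mem_filter.2 ⟨Finset.mem_powerset.2 this.1.subset, this.1, (hH _).2 this.2⟩
  · intro e' he' e'' he'' h
    exact rowDiagram_injective (hbd.1 he').1 (hbd.1 he'').1 h
  · intro E hE
    obtain ⟨-, h1, h2⟩ := Finset.mem_filter.1 hE
    obtain ⟨e', h3, h4, rfl⟩ := exists_rowDiagram_of_isLowerIn hse h1
    exact ⟨e', hbd.2 ⟨h3, h4,
      (isLowerIn_and_isHorizontalStrip_iff hs he h3 h4 hne).1 ⟨h1, (hH _).1 h2⟩⟩, rfl⟩
  · intro e' he'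
    rw [rowDiagram_sdiff (hbd.1 he').1, card_rowDiagram, Finset.prod_pow_eq_pow_sum]

/-! ### Strip conditions for Schur functions and shifted tableaux -/

/-- Semistandard tableaux are strip tableaux with respect to this condition. -/
def ssytStrip (_ : ℕ) (A : Finset (ℕ × ℕ)) : Prop := IsHorizontalStrip A

/-- The strip conditions for primed shifted tableaux; the letters `k'` and `k` are encoded as
`2 * k` and `2 * k + 1`, and `q` says whether primes are allowed on the main diagonal. -/
def shiftedStrip (q : Prop) (a : ℕ) (A : Finset (ℕ × ℕ)) : Prop :=
  if Even a then IsVerticalStrip A ∧ (q ∨ ∀ c ∈ A, c.1 ≠ c.2) else IsHorizontalStrip A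

/-- The weight `x k` of the letter `k` and `y k` of the letter `k'`. -/
def shiftedWeight {R : Type*} (x y : ℕ → R) (a : ℕ) : R :=
  if Even a then y (a / 2) else x (a / 2)

theorem shiftedStrip_even {q : Prop} {k : ℕ} {A : Finset (ℕ × ℕ)} :
    shiftedStrip q (2 * k) A ↔ IsVerticalStrip A ∧ (q ∨ ∀ c ∈ A, c.1 ≠ c.2) := by
  simp [shiftedStrip]

theorem shiftedStrip_odd {q : Prop} {k : ℕ} {A : Finset (ℕ × ℕ)} :
    shiftedStrip q (2 * k + 1) A ↔ IsHorizontalStrip A := by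
  simp [shiftedStrip]

theorem shiftedWeight_even {R : Type*} (x y : ℕ → R) (k : ℕ) :
    shiftedWeight x y (2 * k) = y k := by
  simp [shiftedWeight]

theorem shiftedWeight_odd {R : Type*} (x y : ℕ → R) (k : ℕ) :
    shiftedWeight x y (2 * k + 1) = x k := by
  have : (2 * k + 1) / 2 = k := by omega
  simp [shiftedWeight, this]

/-- The entries of a column of a semistandard tableau are distinct. -/
theorem tableauSum_ssytStrip_eq_zero {R : Type*} [CommRing R] (w : ℕ → R) (n : ℕ) :
    ∀ D : Finset (ℕ × ℕ), (∀ i ≤ n, (i, 0) ∈ D) → tableauSum ssytStrip w n D = 0 := by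
  classical
  induction n with
  | zero => exact fun D hD => tableauSum_zero_of_nonempty _ _ ⟨_, hD 0 le_rfl⟩
  | succ n ih =>
    intro D hD
    rw [tableauSum_succ]
    refine Finset.sum_eq_zero fun E hE => ?_
    obtain ⟨-, hE, hs⟩ := Finset.mem_filter.1 hE
    have hn : (n, 0) ∈ E := by
      by_contra h
      have h' : (n + 1, 0) ∉ E := fun h' => h (hE.col _ (hD n (by omega)) _ h' rfl (by simp))
      have := hs _ (Finset.mem_sdiff.2 ⟨hD n (by omega), h⟩) _
        (Finset.mem_sdiff.2 ⟨hD (n + 1) le_rfl, h'⟩) rfl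
      simp at this
    rw [ih E fun i hi => hE.col _ (hD i (by omega)) _ hn rfl hi, mul_zero]

/-- The indices of the diagonal entries of a primed shifted tableau increase strictly. -/
theorem tableauSum_shiftedStrip_eq_zero {R : Type*} [CommRing R] (q : Prop) (w : ℕ → R) (n : ℕ) :
    ∀ D : Finset (ℕ × ℕ), (∀ i j, i ≤ j → j ≤ n → (i, j) ∈ D) →
      tableauSum (shiftedStrip q) w (2 * n) D = 0 := by
  classical
  induction n with
  | zero => exact fun D hD => tableauSum_zero_of_nonempty _ _ ⟨_, hD 0 0 le_rfl le_rfl⟩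
  | succ n ih =>
    intro D hD
    rw [mul_add, mul_one, tableauSum_succ]
    refine Finset.sum_eq_zero fun E' hE' => ?_
    obtain ⟨-, hE', hs'⟩ := Finset.mem_filter.1 hE'
    rw [shiftedStrip_odd] at hs'
    rw [tableauSum_succ, Finset.mul_sum]
    refine Finset.sum_eq_zero fun E hE => ?_
    obtain ⟨-, hE, hs⟩ := Finset.mem_filter.1 hE
    rw [shiftedStrip_even] at hs
    -- The boxes `(n, n)`, `(n, n + 1)` and `(n + 1, n + 1)` cannot be filled by two letters
    -- with the same index.
    have hnn : (n, n) ∈ E := by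
      by_contra h
      have h1 : (n, n + 1) ∉ E := by
        intro h1
        by_cases h2 : (n, n) ∈ E'
        · exact h (hE.row _ h2 _ h1 rfl (by simp))
        · exact h2 (hE'.row _ (hD n n le_rfl (by omega)) _ (hE.subset h1) rfl (by simp))
      by_cases h2 : (n, n + 1) ∈ E'
      · have h3 : (n, n) ∈ E' := hE'.row _ (hD n n le_rfl (by omega)) _ h2 rfl (by simp)
        have := hs.1 _ (Finset.mem_sdiff.2 ⟨h3, h⟩) _ (Finset.mem_sdiff.2 ⟨h2, h1⟩) rfl
        simp at this
      · have h3 : (n + 1, n + 1) ∉ E' := fun h3 =>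
          h2 (hE'.col _ (hD n (n + 1) (by omega) le_rfl) _ h3 rfl (by simp))
        have := hs' _ (Finset.mem_sdiff.2 ⟨hD n (n + 1) (by omega) le_rfl, h2⟩) _
          (Finset.mem_sdiff.2 ⟨hD _ _ le_rfl le_rfl, h3⟩) rfl
        simp at this
    have hsub : ∀ i j, i ≤ j → j ≤ n → (i, j) ∈ E := by
      intro i j hij hj
      have hin' : (i, n) ∈ E' := hE'.col _ (hD i n (by omega) (by omega)) _ (hE.subset hnn) rfl
        (hij.trans hj)
      have hin := hE.col _ hin' _ hnn rfl (hij.trans hj)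
      exact hE.row _ (hE'.row _ (hD i j hij (by omega)) _ hin' rfl hj) _ hin rfl hj
    rw [ih E hsub, mul_zero, mul_zero]

open Classical in
/-- Removing the primed letters with the largest index `m` from a primed shifted tableau in which
the unprimed letters with index `m` have been removed already. Row `i` consists of the columns `j`
with `i ≤ j < e i`; a last row with one box keeps a primed letter on the main diagonal. -/
theorem tableauSum_succ_of_vertical {R : Type*} [CommRing R] (q : Prop) (w : ℕ → R) {m : ℕ}
    {e : Fin (m + 1) → ℕ} (he : Antitone e) (he2 : ∀ i : Fin m, (i : ℕ) + 2 ≤ e i.castSucc)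
    (hem : m ≤ e (Fin.last m)) :
    tableauSum (shiftedStrip q) w (2 * m + 1) (rowDiagram (fun i => (i : ℕ)) e) =
      (if e (Fin.last m) = m then 1 else if q ∧ e (Fin.last m) = m + 1 then w (2 * m) else 0) *
      ∑ e' ∈ Fintype.piFinset fun i : Fin m => Finset.Icc (e i.castSucc - 1) (e i.castSucc) with
          Antitone e',
        (∏ i, w (2 * m) ^ (e i.castSucc - e' i)) *
          tableauSum (shiftedStrip q) w (2 * m) (rowDiagram (fun i => (i : ℕ)) e') := by
  set s : Fin (m + 1) → ℕ := fun i => (i : ℕ) with hsdef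
  have hs : Monotone s := fun i k h => h
  have hse : ∀ i, s i ≤ e i := by
    intro i
    induction i using Fin.lastCases with
    | last => exact hem
    | cast i => have := he2 i; simp only [hsdef, Fin.val_castSucc]; omega
  -- The last row has to be empty once all letters with index `m` are removed.
  have hvan : ∀ E, IsLowerIn E (rowDiagram s e) → (m, m) ∈ E →
      tableauSum (shiftedStrip q) w (2 * m) E = 0 := by
    intro E hE hmm
    have hlast := (mk_mem_rowDiagram (i := Fin.last m)).1 (hE.subset hmm)
    have hD : ∀ i j, i ≤ j → j ≤ m → (i, j) ∈ rowDiagram s e := by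
      intro i j hij hj
      have := he (Fin.le_last ⟨i, by omega⟩)
      exact mem_rowDiagram.2 ⟨by simp only; omega, hij, by simp only; omega⟩
    refine tableauSum_shiftedStrip_eq_zero q w m E fun i j hij hj => ?_
    exact hE.row _ (hD i j hij hj) _
      (hE.col _ (hD i m (by omega) le_rfl) _ hmm rfl (by simp only; omega)) rfl hj
  have hsnoc : ∀ e' : Fin m → ℕ, rowDiagram s (Fin.snoc (α := fun _ => ℕ) e' m) =
      rowDiagram (fun i => (i : ℕ)) e' := fun e' => rowDiagram_snoc s e'
  rw [tableauSum_succ]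
  -- Which ends `e'` of the first `m` rows are possible.
  have hiff : ∀ e' : Fin m → ℕ, (∀ i : Fin m, (i : ℕ) ≤ e' i) → (∀ i, e' i ≤ e i.castSucc) →
      ((IsLowerIn (rowDiagram (fun i => (i : ℕ)) e') (rowDiagram s e) ∧
        shiftedStrip q (2 * m) (rowDiagram s e \ rowDiagram (fun i => (i : ℕ)) e')) ↔
      (∀ i, e i.castSucc - 1 ≤ e' i) ∧ Antitone e' ∧
        (e (Fin.last m) = m ∨ q ∧ e (Fin.last m) = m + 1)) := by
    intro e' h1 h2
    have h1' : ∀ i, s i ≤ Fin.snoc (α := fun _ => ℕ) e' m i := by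
      intro i
      induction i using Fin.lastCases with
      | last => rw [Fin.snoc_last]; exact le_rfl
      | cast i => rw [Fin.snoc_castSucc]; exact h1 i
    have h2' : ∀ i, Fin.snoc (α := fun _ => ℕ) e' m i ≤ e i := by
      intro i
      induction i using Fin.lastCases with
      | last => rw [Fin.snoc_last]; exact hem
      | cast i => rw [Fin.snoc_castSucc]; exact h2 i
    rw [← hsnoc, isLowerIn_rowDiagram_iff hs he h2', rowDiagram_sdiff h1', shiftedStrip_even,
      isVerticalStrip_rowDiagram_iff]
    constructor
    · rintro ⟨h3, h4, h5⟩
      have h6 : ∀ i, e i.castSucc - 1 ≤ e' i := by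
        intro i
        have := h4 i.castSucc
        rw [Fin.snoc_castSucc] at this
        omega
      refine ⟨h6, antitone_iff_forall_lt.2 fun i k hik => ?_, ?_⟩
      · have := h3 i.castSucc k.castSucc hik
        rw [Fin.snoc_castSucc, Fin.snoc_castSucc] at this
        have h7 := h6 k
        have h8 := he2 k
        exact this (by simp only [hsdef, Fin.val_castSucc]; omega)
      · have h7 := h4 (Fin.last m)
        rw [Fin.snoc_last] at h7
        rcases hem.eq_or_lt with h8 | h8
        · exact Or.inl h8.symm
        · refine Or.inr ⟨h5.resolve_right fun h9 => ?_, by omega⟩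
          refine h9 (m, m) ((mk_mem_rowDiagram (i := Fin.last m)).2 ⟨?_, h8⟩) rfl
          rw [Fin.snoc_last]
    · rintro ⟨h3, h4, h5⟩
      refine ⟨fun i k hik => ?_, fun i => ?_, ?_⟩
      · induction k using Fin.lastCases with
        | last => rw [Fin.snoc_last]; exact fun h => (lt_irrefl _ h).elim
        | cast k =>
          induction i using Fin.lastCases with
          | last => exact (not_lt.2 (Fin.le_last _) hik).elim
          | cast i =>
            rw [Fin.snoc_castSucc, Fin.snoc_castSucc]
            exact fun _ => h4 (le_of_lt hik)
      · induction i using Fin.lastCases with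
        | last => rw [Fin.snoc_last]; omega
        | cast i => rw [Fin.snoc_castSucc]; have := h3 i; omega
      · rcases h5 with h5 | h5
        · refine Or.inr ?_
          rintro ⟨i, j⟩ hc heq
          obtain ⟨hi, h6, h7⟩ := mem_rowDiagram.1 hc
          obtain ⟨i, rfl⟩ : ∃ k : Fin (m + 1), (k : ℕ) = i := ⟨⟨i, hi⟩, rfl⟩
          dsimp only [Fin.eta] at h6 h7 heq
          subst heq
          induction i using Fin.lastCases with
          | last => rw [h5] at h7; simp at h7
          | cast i =>
            rw [Fin.snoc_castSucc] at h6
            have := h3 i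
            have := he2 i
            simp only [Fin.val_castSucc] at h6
            omega
        · exact Or.inl h5.1
  have hle : ∀ {e' : Fin m → ℕ}, (∀ i, e i.castSucc - 1 ≤ e' i) → ∀ i : Fin m, (i : ℕ) ≤ e' i := by
    intro e' h i
    have := h i
    have := he2 i
    omega
  have hexists : ∀ E, IsLowerIn E (rowDiagram s e) → (m, m) ∉ E → ∃ e' : Fin m → ℕ,
      (∀ i : Fin m, (i : ℕ) ≤ e' i) ∧ (∀ i, e' i ≤ e i.castSucc) ∧
        E = rowDiagram (fun i => (i : ℕ)) e' := by
    intro E hE hmm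
    obtain ⟨e', h1, h2, rfl⟩ := exists_rowDiagram_of_isLowerIn hse hE
    refine ⟨fun i => e' i.castSucc, fun i => h1 i.castSucc, fun i => h2 _, ?_⟩
    have hlast : e' (Fin.last m) = m := by
      refine le_antisymm (not_lt.1 fun h => hmm ?_) (h1 (Fin.last m))
      exact (mk_mem_rowDiagram (i := Fin.last m)).2 ⟨le_rfl, h⟩
    rw [← hsnoc]
    congr 1
    funext i
    induction i using Fin.lastCases with
    | last => rw [Fin.snoc_last, hlast]
    | cast i => rw [Fin.snoc_castSucc]
  by_cases hcase : e (Fin.last m) = m ∨ q ∧ e (Fin.last m) = m + 1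
  swap
  · have hzero : (if e (Fin.last m) = m then (1 : R) else
        if q ∧ e (Fin.last m) = m + 1 then w (2 * m) else 0) = 0 := by
      rw [not_or] at hcase
      rw [if_neg hcase.1, if_neg hcase.2]
    rw [hzero, zero_mul]
    refine Finset.sum_eq_zero fun E hE => ?_
    obtain ⟨-, hE, hstrip⟩ := Finset.mem_filter.1 hE
    by_cases hmm : (m, m) ∈ E
    · rw [hvan E hE hmm, mul_zero]
    · obtain ⟨e', h1, h2, rfl⟩ := hexists E hE hmm
      exact (hcase ((hiff e' h1 h2).1 ⟨hE, hstrip⟩).2.2).elim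
  have hfactor : (if e (Fin.last m) = m then (1 : R) else
        if q ∧ e (Fin.last m) = m + 1 then w (2 * m) else 0) =
      w (2 * m) ^ (e (Fin.last m) - m) := by
    rcases hcase with h | h
    · rw [if_pos h, h, Nat.sub_self, pow_zero]
    · rw [if_neg (by omega), if_pos h, h.2, Nat.add_sub_cancel_left, pow_one]
  rw [hfactor, Finset.mul_sum]
  symm
  refine Finset.sum_of_injOn (fun e' => rowDiagram (fun i => (i : ℕ)) e') ?_ ?_ ?_ ?_
  · intro e' he' e'' he'' h
    simp only [Finset.coe_filter, Fintype.mem_piFinset, Finset.mem_Icc, Set.mem_ofPred_eq]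
      at he' he''
    exact rowDiagram_injective (hle fun i => (he'.1 i).1) (hle fun i => (he''.1 i).1) h
  · intro e' he'
    simp only [Finset.coe_filter, Fintype.mem_piFinset, Finset.mem_Icc, Set.mem_ofPred_eq] at he'
    have := (hiff e' (hle fun i => (he'.1 i).1) fun i => (he'.1 i).2).2
      ⟨fun i => (he'.1 i).1, he'.2, hcase⟩
    rw [Finset.mem_coe, Finset.mem_filter, Finset.mem_powerset]
    exact ⟨this.1.subset, this⟩
  · intro E hE hnot
    obtain ⟨-, hE, hstrip⟩ := Finset.mem_filter.1 hE
    by_cases hmm : (m, m) ∈ E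
    · rw [hvan E hE hmm, mul_zero]
    · obtain ⟨e', h1, h2, rfl⟩ := hexists E hE hmm
      have := (hiff e' h1 h2).1 ⟨hE, hstrip⟩
      refine (hnot ⟨e', ?_, rfl⟩).elim
      simp only [Finset.coe_filter, Fintype.mem_piFinset, Finset.mem_Icc, Set.mem_ofPred_eq]
      exact ⟨fun i => ⟨this.1 i, h2 i⟩, this.2.1⟩
  · intro e' he'
    simp only [Finset.mem_filter, Fintype.mem_piFinset, Finset.mem_Icc] at he'
    have h1' : ∀ i, s i ≤ Fin.snoc (α := fun _ => ℕ) e' m i := by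
      intro i
      induction i using Fin.lastCases with
      | last => rw [Fin.snoc_last]; exact le_rfl
      | cast i => rw [Fin.snoc_castSucc]; exact hle (fun i => (he'.1 i).1) i
    rw [← hsnoc, rowDiagram_sdiff h1', card_rowDiagram, Fin.sum_univ_castSucc, pow_add,
      Finset.prod_pow_eq_pow_sum]
    simp only [Fin.snoc_castSucc, Fin.snoc_last]
    ring

/-! ### Alternants -/

/-- The alternant `det (x_j ^ a_i)` in the first `n` variables. -/
noncomputable def alternant {R : Type*} [CommRing R] (n : ℕ) (x : ℕ → R) (a : Fin n → ℕ) : R :=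
  (Matrix.of fun i j : Fin n => x j ^ a i).det

/-- The product of the differences `x_i - x_j` with `i < j < n`. -/
def differenceProduct {R : Type*} [CommRing R] (n : ℕ) (x : ℕ → R) : R :=
  ∏ j ∈ Finset.range n, ∏ i ∈ Finset.range j, (x i - x j)

/-- The determinant is multilinear: a sum of alternants over independent choices of the exponents
is the determinant of the matrix of sums. -/
theorem sum_piFinset_mul_alternant {R : Type*} [CommRing R] {n : ℕ} (x : ℕ → R)
    (S : Fin n → Finset ℕ) (g : Fin n → ℕ → R) (p : Fin n → ℕ → ℕ) :
    ∑ a ∈ Fintype.piFinset S, (∏ i, g i (a i)) * alternant n x (fun i => p i (a i)) =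
      (Matrix.of fun i j : Fin n => ∑ m ∈ S i, g i m * x j ^ p i m).det := by
  have h := MultilinearMap.map_sum_finset
    (Matrix.detRowAlternating (n := Fin n) (R := R)).toMultilinearMap
    (fun i m j => g i m * x j ^ p i m) S
  have h1 : (fun i => ∑ m ∈ S i, fun j : Fin n => g i m * x j ^ p i m) =
      Matrix.of fun i j : Fin n => ∑ m ∈ S i, g i m * x j ^ p i m := by
    funext i j
    simp [Finset.sum_apply]
  rw [h1] at h
  refine Eq.trans ?_ h.symm
  refine Finset.sum_congr rfl fun a _ => ?_
  exact (Matrix.det_mul_column (fun i => g i (a i))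
    (Matrix.of fun i j : Fin n => x j ^ p i (a i))).symm

theorem alternant_eq_zero {R : Type*} [CommRing R] {n : ℕ} (x : ℕ → R) {a : Fin n → ℕ}
    {i k : Fin n} (hik : i ≠ k) (h : a i = a k) : alternant n x a = 0 :=
  Matrix.det_zero_of_row_eq hik (funext fun j => by simp [h])

/-- Subtracting from each row the multiple of the next row that cancels the entry in the last
column extracts the factors `x_j - x_n` from an alternant in `n + 1` variables. -/
theorem alternant_succ {R : Type*} [CommRing R] {n : ℕ} (x : ℕ → R) {b : Fin (n + 1) → ℕ}
    (hb : Antitone b) :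
    alternant (n + 1) x b = x n ^ b (Fin.last n) * (∏ j ∈ Finset.range n, (x j - x n)) *
      (Matrix.of fun i j : Fin n => ∑ m ∈ Finset.Ico (b i.succ) (b i.castSucc),
        x n ^ (b i.castSucc - 1 - m) * x j ^ m).det := by
  set M : Matrix (Fin (n + 1)) (Fin (n + 1)) R := Matrix.of fun i j => x j ^ b i with hM
  let B : Matrix (Fin (n + 1)) (Fin (n + 1)) R := fun i j =>
    Fin.lastCases (motive := fun _ => R) (M (Fin.last n) j)
      (fun i => M i.castSucc j - x n ^ (b i.castSucc - b i.succ) * M i.succ j) i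
  have hBlast : ∀ j, B (Fin.last n) j = M (Fin.last n) j := fun j => by simp [B]
  have hBcast : ∀ i j, B (Fin.castSucc i) j =
      M i.castSucc j - x n ^ (b i.castSucc - b i.succ) * M i.succ j := fun i j => by simp [B]
  have hle : ∀ i : Fin n, b i.succ ≤ b i.castSucc := fun i =>
    hb (Fin.castSucc_lt_succ (i := i)).le
  have hdet : M.det = B.det := by
    rw [← Matrix.det_submatrix_equiv_self Fin.revPerm M,
      ← Matrix.det_submatrix_equiv_self Fin.revPerm B]
    refine Matrix.det_eq_of_forall_row_eq_smul_add_pred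
      (fun i => x n ^ (b i.rev.castSucc - b i.rev.succ)) (fun j => ?_) fun i j => ?_
    · simp [hBlast]
    · simp only [Matrix.submatrix_apply, Fin.revPerm_apply, Fin.rev_succ, Fin.rev_castSucc, hBcast]
      ring
  have hB0 : ∀ i : Fin n, B i.castSucc (Fin.last n) = 0 := by
    intro i
    rw [hBcast]
    simp only [hM, Matrix.of_apply, Fin.val_last]
    rw [← pow_add, Nat.sub_add_cancel (hle i), sub_self]
  have hBij : ∀ i j : Fin n, B i.castSucc j.castSucc = (x j - x n) *
      ∑ m ∈ Finset.Ico (b i.succ) (b i.castSucc), x n ^ (b i.castSucc - 1 - m) * x j ^ m := by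
    intro i j
    rw [hBcast]
    simp only [hM, Matrix.of_apply, Fin.val_castSucc]
    obtain ⟨d, hd⟩ := Nat.exists_eq_add_of_le (hle i)
    rw [hd, Nat.add_sub_cancel_left, Finset.sum_Ico_eq_sum_range, Nat.add_sub_cancel_left]
    have h := (Commute.all (x j) (x n)).mul_geom_sum₂ d
    calc x j ^ (b i.succ + d) - x n ^ d * x j ^ b i.succ
        = x j ^ b i.succ * (x j ^ d - x n ^ d) := by ring
      _ = _ := by
        rw [← h, Finset.mul_sum, Finset.mul_sum, Finset.mul_sum]
        refine Finset.sum_congr rfl fun k _ => ?_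
        rw [show b i.succ + d - 1 - (b i.succ + k) = d - 1 - k by omega]
        ring
  rw [alternant, ← hM, hdet, Matrix.det_succ_column B (Fin.last n), Fin.sum_univ_castSucc]
  simp only [hB0, mul_zero, zero_mul, Finset.sum_const_zero, zero_add]
  rw [hBlast, Fin.succAbove_last, Fin.val_last, Even.neg_one_pow ⟨n, rfl⟩, one_mul, mul_assoc]
  congr 1
  rw [Finset.prod_range, ← Matrix.det_mul_row]
  congr 1
  ext i j
  simp [hBij]

theorem sum_piFinset_snoc {R : Type*} [AddCommMonoid R] {n : ℕ} (S : Fin (n + 1) → Finset ℕ)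
    (f : (Fin (n + 1) → ℕ) → R) :
    ∑ e ∈ Fintype.piFinset S, f e =
      ∑ l ∈ S (Fin.last n), ∑ e ∈ Fintype.piFinset fun i : Fin n => S i.castSucc,
        f (Fin.snoc (α := fun _ => ℕ) e l) := by
  rw [← Finset.sum_product']
  refine Finset.sum_nbij' (fun e => (e (Fin.last n), fun i => e i.castSucc))
    (fun p => Fin.snoc (α := fun _ => ℕ) p.2 p.1) ?_ ?_ ?_ ?_ ?_
  · intro e he
    rw [Fintype.mem_piFinset] at he
    exact Finset.mem_product.2 ⟨he _, Fintype.mem_piFinset.2 fun i => he _⟩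
  · intro p hp
    obtain ⟨h1, h2⟩ := Finset.mem_product.1 hp
    rw [Fintype.mem_piFinset] at h2 ⊢
    intro i
    induction i using Fin.lastCases with
    | last => rwa [Fin.snoc_last]
    | cast i => rw [Fin.snoc_castSucc]; exact h2 i
  · exact fun e _ => Fin.snoc_init_self e
  · exact fun p _ => by simp
  · exact fun e _ => congrArg f (Fin.snoc_init_self e).symm

/-- The sum over interlacing sequences of alternants in `n` variables is an alternant in `n + 1`
variables. The row ends `e` and the exponents `b` differ by a shift in each row, and `p i` is the
shift that turns the new end of row `i` into an exponent. -/
theorem sum_interlacing_alternant {R : Type*} [CommRing R] {n : ℕ} (x : ℕ → R)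
    {e : Fin (n + 1) → ℕ} {b : Fin (n + 1) → ℕ} (hb : Antitone b) {p : Fin n → ℕ → ℕ}
    (hp : ∀ i, ∀ m ∈ Finset.Icc (e i.succ) (e i.castSucc),
      p i m + e i.castSucc + 1 = m + b i.castSucc)
    (hbe : ∀ i : Fin n, b i.succ + e i.castSucc + 1 = b i.castSucc + e i.succ)
    (he : Antitone e) :
    (∑ e' ∈ Fintype.piFinset fun i : Fin n => Finset.Icc (e i.succ) (e i.castSucc),
      (∏ i, x n ^ (e i.castSucc - e' i)) * alternant n x fun i => p i (e' i)) *
        (x n ^ b (Fin.last n) * ∏ j ∈ Finset.range n, (x j - x n)) = alternant (n + 1) x b := by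
  rw [alternant_succ x hb, mul_comm]
  congr 1
  rw [sum_piFinset_mul_alternant x _ (fun i m => x n ^ (e i.castSucc - m)) p]
  congr 1
  ext i j
  simp only [Matrix.of_apply]
  have h2 := hbe i
  have h3 := hb (Fin.castSucc_lt_succ (i := i)).le
  have h4 := he (Fin.castSucc_lt_succ (i := i)).le
  refine Finset.sum_nbij' (fun m => p i m) (fun m => m + e i.castSucc + 1 - b i.castSucc) ?_ ?_ ?_
    ?_ ?_
  · intro m hm
    have h1 := hp i m hm
    rw [Finset.mem_Icc] at hm
    rw [Finset.mem_Ico]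
    omega
  · intro m hm
    rw [Finset.mem_Ico] at hm
    rw [Finset.mem_Icc]
    omega
  · intro m hm
    have h1 := hp i m hm
    omega
  · intro m hm
    rw [Finset.mem_Ico] at hm
    have h1 := hp i (m + e i.castSucc + 1 - b i.castSucc) (by rw [Finset.mem_Icc]; omega)
    omega
  · intro m hm
    have h1 := hp i m hm
    rw [Finset.mem_Icc] at hm
    congr 2
    omega

/-! ### Alternant formulas for the generating functions -/

theorem differenceProduct_succ {R : Type*} [CommRing R] (n : ℕ) (x : ℕ → R) :
    differenceProduct (n + 1) x =
      differenceProduct n x * ∏ i ∈ Finset.range n, (x i - x n) :=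
  Finset.prod_range_succ _ _

theorem rowDiagram_zero (s e : Fin 0 → ℕ) : rowDiagram s e = ∅ := by
  simp [rowDiagram]

theorem antitone_of_interlacing {n : ℕ} {e : Fin (n + 1) → ℕ} (he : Antitone e) {e' : Fin n → ℕ}
    (h : ∀ i : Fin n, e i.succ ≤ e' i ∧ e' i ≤ e i.castSucc) : Antitone e' :=
  antitone_iff_forall_lt.2 fun i k hik =>
    (h k).2.trans ((he (Fin.succ_le_castSucc_iff.2 hik)).trans (h i).1)

theorem antitone_snoc {n : ℕ} {e' : Fin n → ℕ} (he' : Antitone e') {l : ℕ} (hl : ∀ i, l ≤ e' i) :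
    Antitone (Fin.snoc (α := fun _ => ℕ) e' l) := by
  refine antitone_iff_forall_lt.2 fun i k hik => ?_
  induction i using Fin.lastCases with
  | last => exact (not_lt.2 (Fin.le_last _) hik).elim
  | cast i =>
    rw [Fin.snoc_castSucc]
    induction k using Fin.lastCases with
    | last => rw [Fin.snoc_last]; exact hl i
    | cast k => rw [Fin.snoc_castSucc]; exact he' (le_of_lt hik)

/-- The bialternant formula for Schur functions. -/
theorem tableauSum_ssytStrip_mul {R : Type*} [CommRing R] (x : ℕ → R) (n : ℕ) :
    ∀ e : Fin n → ℕ, Antitone e →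
      tableauSum ssytStrip x n (rowDiagram (fun _ => 0) e) * differenceProduct n x =
        alternant n x fun i => e i + (n - 1 - i) := by
  induction n with
  | zero =>
    intro e _
    simp [rowDiagram_zero, tableauSum_empty, differenceProduct, alternant]
  | succ n ih =>
    intro e he
    have hb : Antitone fun i : Fin (n + 1) => e i + (n - i) := fun i k hik => by
      have := he hik
      have := Fin.le_def.1 hik
      dsimp only
      omega
    have hinter := sum_interlacing_alternant x hb
      (p := fun i m => m + (n - 1 - i)) (e := e) (by
        intro i m _
        have := i.2
        simp only [Fin.val_castSucc]
        omega) (by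
        intro i
        have := i.2
        simp only [Fin.val_castSucc, Fin.val_succ]
        omega) he
    rw [tableauSum_succ_of_horizontal (fun A => Iff.rfl) (fun _ _ _ => le_rfl) he
      (fun _ => Nat.zero_le _) (fun i => (Nat.eq_zero_or_pos (e i.succ)).imp (fun h => h.le) id),
      sum_piFinset_snoc, Finset.sum_eq_single 0]
    · simp only [Fin.snoc_last, Fin.snoc_castSucc, Fin.prod_univ_castSucc]
      rw [differenceProduct_succ]
      simp only [Nat.add_sub_cancel]
      rw [← hinter, Finset.sum_mul, Finset.sum_mul]
      refine Finset.sum_congr rfl fun e' he' => ?_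
      rw [Fintype.mem_piFinset] at he'
      have hanti := antitone_of_interlacing he fun i => Finset.mem_Icc.1 (he' i)
      rw [← ih e' hanti, rowDiagram_snoc (fun _ => 0) e']
      simp only [Nat.sub_zero, Fin.val_last, Nat.sub_self, Nat.add_zero]
      ring
    · intro l hl hl0
      rw [Fin.snoc_last, Finset.mem_Icc] at hl
      refine Finset.sum_eq_zero fun e' he' => ?_
      simp only [Fin.snoc_castSucc, Fintype.mem_piFinset, Finset.mem_Icc] at he'
      rw [tableauSum_ssytStrip_eq_zero x n, mul_zero]
      intro i hi
      obtain ⟨i, rfl⟩ : ∃ k : Fin (n + 1), (k : ℕ) = i := ⟨⟨i, by omega⟩, rfl⟩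
      refine mk_mem_rowDiagram.2 ⟨le_rfl, ?_⟩
      induction i using Fin.lastCases with
      | last => rw [Fin.snoc_last]; omega
      | cast i =>
        rw [Fin.snoc_castSucc]
        have := he (Fin.le_last i.succ)
        have := (he' i).1
        omega
    · simp

/-- Removing the primed letters with the largest index contributes the factors `x_i + y_n`. -/
theorem tableauSum_shiftedStrip_odd_mul {R : Type*} [CommRing R] (q : Prop) [Decidable q]
    (x y : ℕ → R) {n : ℕ} {C : R}
    (ih : ∀ e : Fin n → ℕ, Antitone e → (∀ i : Fin n, (i : ℕ) + 1 ≤ e i) →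
      tableauSum (shiftedStrip q) (shiftedWeight x y) (2 * n) (rowDiagram (fun i => (i : ℕ)) e) *
        differenceProduct n x = C * alternant n x fun i => e i - i - 1)
    {e : Fin (n + 1) → ℕ} (he : Antitone e) (he2 : ∀ i : Fin n, (i : ℕ) + 2 ≤ e i.castSucc)
    (hen : n ≤ e (Fin.last n)) :
    tableauSum (shiftedStrip q) (shiftedWeight x y) (2 * n + 1)
        (rowDiagram (fun i => (i : ℕ)) e) * differenceProduct n x =
      (if e (Fin.last n) = n then 1 else if q ∧ e (Fin.last n) = n + 1 then y n else 0) *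
        (C * (∏ j ∈ Finset.range n, (x j + y n)) *
          alternant n x fun i => e i.castSucc - i - 2) := by
  classical
  have hcoll : ∑ e' ∈ Fintype.piFinset fun i : Fin n =>
        Finset.Icc (e i.castSucc - 1) (e i.castSucc),
      (∏ i, y n ^ (e i.castSucc - e' i)) * alternant n x (fun i => e' i - i - 1) =
      (∏ j ∈ Finset.range n, (x j + y n)) * alternant n x fun i => e i.castSucc - i - 2 := by
    rw [sum_piFinset_mul_alternant x _ (fun i m => y n ^ (e i.castSucc - m))
      (fun i m => m - i - 1), Finset.prod_range, alternant, ← Matrix.det_mul_row]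
    congr 1
    ext i j
    simp only [Matrix.of_apply]
    obtain ⟨t, ht⟩ := Nat.exists_eq_add_of_le (he2 i)
    rw [ht, show (i : ℕ) + 2 + t - 1 = i + 1 + t by omega,
      show (i : ℕ) + 2 + t = (i + 1 + t) + 1 by omega, Finset.sum_Icc_succ_top (by omega)]
    simp only [Finset.Icc_self, Finset.sum_singleton]
    rw [show (i : ℕ) + 1 + t + 1 - (i + 1 + t) = 1 by omega,
      show (i : ℕ) + 1 + t - i - 1 = t by omega, Nat.sub_self,
      show (i : ℕ) + 1 + t + 1 - i - 1 = t + 1 by omega,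
      show (i : ℕ) + 1 + t + 1 - i - 2 = t by omega]
    ring
  rw [tableauSum_succ_of_vertical q _ he he2 hen, mul_assoc, shiftedWeight_even, mul_assoc C,
    ← hcoll, Finset.sum_mul]
  refine congrArg₂ _ (by congr) ?_
  rw [Finset.mul_sum]
  -- Sequences that fail to decrease contribute alternants with two equal rows.
  have hfilter : ∀ e' ∈ Fintype.piFinset fun i : Fin n =>
        Finset.Icc (e i.castSucc - 1) (e i.castSucc),
      C * ((∏ i, y n ^ (e i.castSucc - e' i)) * alternant n x (fun i => e' i - i - 1)) ≠ 0 →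
        Antitone e' := by
    intro e' he' hne
    by_contra hanti
    rw [Fintype.mem_piFinset] at he'
    apply hne
    suffices h : ∃ i k : Fin n, i ≠ k ∧ e' i - i - 1 = e' k - k - 1 by
      obtain ⟨i, k, hik, h⟩ := h
      rw [alternant_eq_zero x hik h, mul_zero, mul_zero]
    by_contra! hcon
    apply hanti
    cases n with
    | zero => exact fun i => i.elim0
    | succ n =>
      rw [Fin.antitone_iff_succ_le]
      intro i
      by_contra! hlt
      have h1 := Finset.mem_Icc.1 (he' i.castSucc)
      have h2 := Finset.mem_Icc.1 (he' i.succ)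
      have h3 := he2 i.castSucc
      have h4 := he2 i.succ
      have h5 : e i.succ.castSucc ≤ e i.castSucc.castSucc :=
        he (Fin.castSucc_le_castSucc_iff.2 (Fin.castSucc_lt_succ (i := i)).le)
      have h6 := hcon i.castSucc i.succ (Fin.castSucc_lt_succ (i := i)).ne
      simp only [Fin.val_castSucc, Fin.val_succ] at h3 h4 h6
      omega
  rw [← Finset.sum_filter_of_ne hfilter]
  refine Finset.sum_congr rfl fun e' he' => ?_
  obtain ⟨h1, h2⟩ := Finset.mem_filter.1 he'
  rw [Fintype.mem_piFinset] at h1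
  have h3 : ∀ i : Fin n, (i : ℕ) + 1 ≤ e' i := fun i => by
    have := Finset.mem_Icc.1 (h1 i)
    have := he2 i
    omega
  rw [mul_assoc, ih e' h2 h3]
  ring

/-- The alternant formula for primed shifted tableaux of length `n` in the letters with `n`
indices. -/
theorem tableauSum_shiftedStrip_mul {R : Type*} [CommRing R] (q : Prop) [Decidable q]
    (x y : ℕ → R) (n : ℕ) :
    ∀ e : Fin n → ℕ, Antitone e → (∀ i : Fin n, (i : ℕ) + 1 ≤ e i) →
      tableauSum (shiftedStrip q) (shiftedWeight x y) (2 * n) (rowDiagram (fun i => (i : ℕ)) e) *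
        differenceProduct n x =
      (∏ k ∈ Finset.range n, ((x k + if q then y k else 0) * ∏ i ∈ Finset.range k, (x i + y k))) *
        alternant n x fun i => e i - i - 1 := by
  induction n with
  | zero =>
    intro e _ _
    simp [rowDiagram_zero, tableauSum_empty, differenceProduct, alternant]
  | succ n ih =>
    intro e he he1
    set C := ∏ k ∈ Finset.range n,
      ((x k + if q then y k else 0) * ∏ i ∈ Finset.range k, (x i + y k)) with hC
    have hb : Antitone fun i : Fin (n + 1) => e i - i - 1 := fun i k hik => by
      have := he hik
      have := Fin.le_def.1 hik
      dsimp only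
      omega
    have he2 : ∀ i : Fin n, (i : ℕ) + 2 ≤ e i.succ := fun i => by
      have := he1 i.succ
      rw [Fin.val_succ] at this
      omega
    have hinter := sum_interlacing_alternant x hb
      (p := fun i m => m - i - 2) (e := e) (by
        intro i m hm
        have := he2 i
        rw [Finset.mem_Icc] at hm
        simp only [Fin.val_castSucc]
        omega) (by
        intro i
        have := he2 i
        have := he (Fin.castSucc_lt_succ (i := i)).le
        simp only [Fin.val_castSucc, Fin.val_succ]
        omega) he
    have hlast := he1 (Fin.last n)
    rw [Fin.val_last] at hlast
    -- Without its unprimed letters with index `n`, the last row ends before column `l`; it is empty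
    -- or consists of one primed letter on the diagonal.
    have hrow : ∑ l ∈ Finset.Icc n (e (Fin.last n)), x n ^ (e (Fin.last n) - l) *
          (if l = n then 1 else if q ∧ l = n + 1 then y n else 0) =
        (x n + if q then y n else 0) * x n ^ (e (Fin.last n) - n - 1) := by
      have hsub : Finset.Icc n (n + 1) ⊆ Finset.Icc n (e (Fin.last n)) :=
        Finset.Icc_subset_Icc le_rfl hlast
      rw [← Finset.sum_subset hsub, Finset.sum_Icc_succ_top (by omega)]
      · obtain ⟨t, ht⟩ := Nat.exists_eq_add_of_le hlast
        rw [ht, show n + 1 + t - n - 1 = t by omega]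
        simp only [Finset.Icc_self, Finset.sum_singleton, Nat.add_sub_cancel_left, if_true,
          show n + 1 + t - n = t + 1 by omega, Nat.succ_ne_self, if_false, and_true]
        ring
      · intro l _ hl
        rw [Finset.mem_Icc] at hl
        rw [if_neg (by omega), if_neg (by omega), mul_zero]
    rw [show 2 * (n + 1) = 2 * n + 1 + 1 by ring,
      tableauSum_succ_of_horizontal (fun A => shiftedStrip_odd) (fun _ _ h => h) he
      (fun i => (Nat.le_succ _).trans (he1 i)) (fun i => Or.inr (he1 i.succ)),
      sum_piFinset_snoc, Finset.prod_range_succ, ← hC, ← hinter, differenceProduct_succ]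
    simp only [Fin.snoc_last, Fin.snoc_castSucc, Fin.prod_univ_castSucc, Fin.val_last,
      shiftedWeight_odd]
    calc _ = ∑ l ∈ Finset.Icc n (e (Fin.last n)),
          ∑ e' ∈ Fintype.piFinset fun i : Fin n => Finset.Icc (e i.succ) (e i.castSucc),
            (x n ^ (e (Fin.last n) - l) *
              (if l = n then 1 else if q ∧ l = n + 1 then y n else 0)) *
            (((∏ i, x n ^ (e i.castSucc - e' i)) * alternant n x fun i => e' i - i - 2) *
              (C * (∏ j ∈ Finset.range n, (x j + y n)) *
                ∏ i ∈ Finset.range n, (x i - x n))) := by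
          simp only [Finset.sum_mul]
          refine Finset.sum_congr rfl fun l hl => Finset.sum_congr rfl fun e' he' => ?_
          rw [Finset.mem_Icc] at hl
          rw [Fintype.mem_piFinset] at he'
          have hodd := tableauSum_shiftedStrip_odd_mul q x y ih
            (e := Fin.snoc (α := fun _ => ℕ) e' l) (antitone_snoc
              (antitone_of_interlacing he fun i => Finset.mem_Icc.1 (he' i)) fun i =>
                hl.2.trans ((he (Fin.le_last _)).trans (Finset.mem_Icc.1 (he' i)).1)) (by
              intro i
              rw [Fin.snoc_castSucc]
              exact (he2 i).trans (Finset.mem_Icc.1 (he' i)).1) (by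
              rw [Fin.snoc_last]
              exact hl.1)
          simp only [Fin.snoc_last, Fin.snoc_castSucc] at hodd
          linear_combination (∏ i, x n ^ (e i.castSucc - e' i)) * x n ^ (e (Fin.last n) - l) *
            (∏ i ∈ Finset.range n, (x i - x n)) * hodd
      _ = _ := by
          rw [← Finset.sum_mul_sum, hrow, ← Finset.sum_mul]
          ring

/-! ### Cancelling the difference product -/

theorem differenceProduct_ne_zero {R : Type*} [CommRing R] [IsDomain R] (n : ℕ) {x : ℕ → R}
    (hx : Function.Injective x) : differenceProduct n x ≠ 0 := by
  refine Finset.prod_ne_zero_iff.2 fun j _ => Finset.prod_ne_zero_iff.2 fun i hi => ?_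
  exact sub_ne_zero.2 fun h => (Finset.mem_range.1 hi).ne (hx h)

/-- The factorisation of the generating function of primed shifted tableaux. Counting from
`0`, row `i` has `λ_i + n - i` boxes and starts in column `i`, so it ends before column `λ_i + n`.
Hence the same alternant occurs on both sides, and the difference product can be cancelled for indeterminates over the integers. -/
theorem tableauSum_shiftedStrip_eq {R : Type*} [CommRing R] (q : Prop) [Decidable q]
    (x y : ℕ → R) {n : ℕ} {f : Fin n → ℕ} (hf : Antitone f) :
    tableauSum (shiftedStrip q) (shiftedWeight x y) (2 * n)
        (rowDiagram (fun i => (i : ℕ)) fun i => f i + n) =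
      tableauSum ssytStrip x n (rowDiagram (fun _ => 0) f) *
        ∏ k ∈ Finset.range n,
          ((x k + if q then y k else 0) * ∏ i ∈ Finset.range k, (x i + y k)) := by
  have generic : ∀ {S : Type} [CommRing S] [IsDomain S] (x y : ℕ → S), Function.Injective x →
      tableauSum (shiftedStrip q) (shiftedWeight x y) (2 * n)
          (rowDiagram (fun i => (i : ℕ)) fun i => f i + n) =
        tableauSum ssytStrip x n (rowDiagram (fun _ => 0) f) *
          ∏ k ∈ Finset.range n,
            ((x k + if q then y k else 0) * ∏ i ∈ Finset.range k, (x i + y k)) := by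
    intro S _ _ x y hx
    have h1 := tableauSum_shiftedStrip_mul q x y n (fun i => f i + n)
      (fun i k hik => Nat.add_le_add_right (hf hik) n) (fun i => by have := i.2; omega)
    have h2 := tableauSum_ssytStrip_mul x n f hf
    have h3 : (fun i : Fin n => f i + n - i - 1) = fun i : Fin n => f i + (n - 1 - i) := by
      funext i
      have := i.2
      omega
    rw [h3, ← h2] at h1
    apply mul_right_cancel₀ (differenceProduct_ne_zero n hx)
    rw [h1]
    ring
  have h := generic (S := MvPolynomial (ℕ ⊕ ℕ) ℤ) (fun k => MvPolynomial.X (Sum.inl k))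
    (fun k => MvPolynomial.X (Sum.inr k))
    fun a b hab => Sum.inl_injective (MvPolynomial.X_injective hab)
  have h' := congrArg (MvPolynomial.eval₂Hom (Int.castRingHom R) (Sum.elim x y)) h
  have hw : ∀ a, MvPolynomial.eval₂Hom (Int.castRingHom R) (Sum.elim x y)
      (shiftedWeight (fun k => MvPolynomial.X (Sum.inl k)) (fun k => MvPolynomial.X (Sum.inr k)) a) =
      shiftedWeight x y a := by
    intro a
    unfold shiftedWeight
    split_ifs <;> simp
  simp only [map_mul, map_prod, map_add, map_tableauSum, hw, apply_ite, map_zero,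
    MvPolynomial.eval₂Hom_X', Sum.elim_inl, Sum.elim_inr] at h'
  split_ifs at h' ⊢ <;> exact h'

/-- Extension of finitely many variables by zero. -/
def extendByZero {R : Type*} [Zero R] {n : ℕ} (x : Fin n → R) : ℕ → R :=
  fun k => if h : k < n then x ⟨k, h⟩ else 0

theorem extendByZero_val {R : Type*} [Zero R] {n : ℕ} (x : Fin n → R) (i : Fin n) :
    extendByZero x i = x i := by
  simp [extendByZero]

/-- The diagonal and the strictly upper factors, grouped by rows. -/
theorem prod_range_eq {R : Type*} [CommRing R] (q : Prop) [Decidable q] (x y : ℕ → R) (n : ℕ) :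
    ∏ k ∈ Finset.range n, ((x k + if q then y k else 0) * ∏ i ∈ Finset.range k, (x i + y k)) =
      ∏ i ∈ Finset.range n, ∏ j ∈ Finset.Ico i n, (x i + if q ∨ i ≠ j then y j else 0) := by
  rw [Finset.prod_comm' (t' := Finset.range n) (s' := fun j => Finset.range (j + 1))]
  · refine Finset.prod_congr rfl fun k _ => ?_
    rw [Finset.prod_range_succ, mul_comm]
    congr 1
    · refine Finset.prod_congr rfl fun i hi => ?_
      rw [if_pos (Or.inr (Finset.mem_range.1 hi).ne)]
    · simp
  · intro i j
    simp only [Finset.mem_range, Finset.mem_Ico]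
    omega

theorem prod_Ico_extendByZero {R : Type*} [CommRing R] (q : Prop) [Decidable q] {n : ℕ}
    (x y : Fin n → R) :
    ∏ i ∈ Finset.range n, ∏ j ∈ Finset.Ico i n,
        (extendByZero x i + if q ∨ i ≠ j then extendByZero y j else 0) =
      ∏ i, ∏ j ∈ Finset.Ici i, (x i + if q ∨ i ≠ j then y j else 0) := by
  rw [Finset.prod_range]
  refine Finset.prod_congr rfl fun i _ => ?_
  have h : Finset.Ico (i : ℕ) n = (Finset.Ici i).map Fin.valEmbedding := by
    ext k
    simp only [Finset.mem_Ico, Finset.mem_map, Finset.mem_Ici, Fin.valEmbedding_apply]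
    exact ⟨fun h => ⟨⟨k, h.2⟩, Fin.le_def.2 h.1, rfl⟩, by
      rintro ⟨j, hj, rfl⟩; exact ⟨hj, j.2⟩⟩
  rw [h, Finset.prod_map]
  refine Finset.prod_congr rfl fun j _ => ?_
  simp [extendByZero_val, Fin.ext_iff]

/-! ### Diagrams, tableaux and letters -/

theorem youngDiagram_cells_eq {lam : YoungDiagram} {n : ℕ} (hlam : lam.colLen 0 ≤ n) :
    lam.cells = rowDiagram (fun _ : Fin n => 0) fun i => lam.rowLen i := by
  ext ⟨i, j⟩
  rw [YoungDiagram.mem_cells, mem_rowDiagram]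
  constructor
  · intro h
    have h1 : (i, 0) ∈ lam := lam.up_left_mem le_rfl (Nat.zero_le j) h
    exact ⟨(YoungDiagram.mem_iff_lt_colLen.1 h1).trans_le hlam, Nat.zero_le _,
      YoungDiagram.mem_iff_lt_rowLen.1 h⟩
  · exact fun ⟨_, _, h⟩ => YoungDiagram.mem_iff_lt_rowLen.2 h

theorem shiftedDiagram_addStaircase (lam : YoungDiagram) (n : ℕ) :
    (addStaircase lam n).shiftedDiagram =
      rowDiagram (fun i : Fin n => (i : ℕ)) fun i => lam.rowLen i + n := by
  ext ⟨i, j⟩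
  rw [StrictPartition.mem_shiftedDiagram, mem_rowDiagram]
  simp only [addStaircase, List.length_ofFn, List.getElem_ofFn]
  refine exists_congr fun h => ?_
  omega

theorem shiftedDiagram_staircase (n : ℕ) :
    (staircase n).shiftedDiagram = rowDiagram (fun i : Fin n => (i : ℕ)) fun _ => n := by
  rw [staircase, shiftedDiagram_addStaircase]
  congr
  funext i
  have : (⊥ : YoungDiagram).rowLen i = 0 := by
    by_contra h
    exact YoungDiagram.notMem_bot _ (YoungDiagram.mem_iff_lt_rowLen.2 (Nat.pos_of_ne_zero h))
  rw [this, Nat.zero_add]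

/-- The Schur function as a generating function of strip tableaux. -/
theorem schurS_eq_tableauSum {R : Type*} [CommRing R] {n : ℕ} (lam : YoungDiagram)
    (x : Fin n → R) : schurS lam x = tableauSum ssytStrip (extendByZero x) n lam.cells := by
  classical
  rw [schurS, tableauSum]
  refine Finset.sum_bij (fun T _ c => ⟨T.1 c.1.1 c.1.2, T.2 c.1 c.2⟩) ?_ ?_ ?_ ?_
  · intro T _
    refine Finset.mem_filter.2 ⟨Finset.mem_univ _, ?_, ?_, ?_⟩
    · rintro ⟨⟨i, j⟩, hc⟩ ⟨⟨i', j'⟩, hd⟩ h1 h2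
      dsimp only at h1 h2
      subst h1
      exact Fin.le_def.2 (T.1.row_weak_of_le h2 hd)
    · rintro ⟨⟨i, j⟩, hc⟩ ⟨⟨i', j'⟩, hd⟩ h1 h2
      dsimp only at h1 h2
      subst h1
      exact Fin.le_def.2 (T.1.col_weak h2 hd)
    · rintro a ⟨i, j⟩ hc ⟨i', j'⟩ hd h1
      dsimp only at h1
      subst h1
      obtain ⟨hc, hca⟩ := mem_fillingFiber.1 hc
      obtain ⟨hd, hda⟩ := mem_fillingFiber.1 hd
      have heq := congrArg Fin.val (hca.trans hda.symm)
      dsimp only at heq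
      rcases lt_trichotomy i i' with h | rfl | h
      · exact ((T.1.col_strict h hd).ne heq).elim
      · rfl
      · exact ((T.1.col_strict h hc).ne heq.symm).elim
  · intro T _ T' _ h
    apply Subtype.ext
    ext i j
    by_cases hc : (i, j) ∈ lam
    · exact congrArg Fin.val (congrFun h ⟨(i, j), hc⟩)
    · rw [T.1.zeros hc, T'.1.zeros hc]
  · intro T hT
    obtain ⟨h1, h2, h3⟩ := (Finset.mem_filter.1 hT).2
    let S : SemistandardYoungTableau lam :=
      { entry := fun i j => if h : (i, j) ∈ lam.cells then T ⟨(i, j), h⟩ else 0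
        row_weak' := by
          intro i j1 j2 hj hc
          have hc' : (i, j1) ∈ lam := lam.up_left_mem le_rfl hj.le hc
          rw [dif_pos ((YoungDiagram.mem_cells _).2 hc), dif_pos ((YoungDiagram.mem_cells _).2 hc')]
          exact Fin.le_def.1 (h1 _ _ rfl hj.le)
        col_strict' := by
          intro i1 i2 j hi hc
          have hc' : (i1, j) ∈ lam := lam.up_left_mem hi.le le_rfl hc
          rw [dif_pos ((YoungDiagram.mem_cells _).2 hc), dif_pos ((YoungDiagram.mem_cells _).2 hc')]
          refine lt_of_le_of_ne (Fin.le_def.1 (h2 _ _ rfl hi.le)) fun heq => ?_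
          have := h3 (T ⟨(i2, j), (YoungDiagram.mem_cells _).2 hc⟩) (i1, j)
            (mem_fillingFiber.2 ⟨(YoungDiagram.mem_cells _).2 hc', Fin.ext heq⟩) (i2, j)
            (mem_fillingFiber.2 ⟨(YoungDiagram.mem_cells _).2 hc, rfl⟩) rfl
          simp only [Prod.mk.injEq, and_true] at this
          omega
        zeros' := by
          intro i j hc
          rw [dif_neg (fun h => hc ((YoungDiagram.mem_cells _).1 h))] }
    have hS : ∀ c (h : c ∈ lam.cells), S c.1 c.2 = T ⟨c, h⟩ := fun c h => dif_pos h
    refine ⟨⟨S, fun c hc => ?_⟩, Finset.mem_univ _, ?_⟩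
    · rw [hS c ((YoungDiagram.mem_cells _).2 hc)]
      exact Fin.is_lt _
    · funext c
      exact Fin.ext (hS c.1 c.2)
  · intro T _
    have h1 : ∀ c : {c // c ∈ lam.cells}, extendByZero x (T.1 c.1.1 c.1.2) =
        ∏ k : Fin n, if T.1 c.1.1 c.1.2 = k then x k else 1 := by
      intro c
      have hlt := T.2 c.1 ((YoungDiagram.mem_cells _).1 c.2)
      rw [Finset.prod_eq_single (⟨T.1 c.1.1 c.1.2, hlt⟩ : Fin n)]
      · simp [extendByZero, hlt]
      · intro k _ hk
        rw [if_neg fun h => hk (Fin.ext h.symm)]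
      · simp
    simp only [h1]
    rw [Finset.prod_coe_sort lam.cells fun c =>
      ∏ k : Fin n, if T.1 c.1 c.2 = k then x k else 1, Finset.prod_comm]
    refine Finset.prod_congr rfl fun k _ => ?_
    rw [← Finset.prod_filter, Finset.prod_const, BoundedSSYT.count]

/-- The variable attached to a letter. -/
def letterWeight {R : Type*} {n : ℕ} (x y : Fin n → R) (a : PrimedLetter n) : R :=
  if (ofLex a).2 then x a.index else y a.index

theorem monomial_eq_prod {R : Type*} [CommRing R] {μ : StrictPartition} {n : ℕ} (x y : Fin n → R)
    (T : ShiftedFilling μ n) : T.monomial x y = ∏ c, letterWeight x y (T c) := by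
  classical
  have h : ∀ c, letterWeight x y (T c) = (∏ k, if T c = PrimedLetter.unprimed k then x k else 1) *
      ∏ k, if T c = PrimedLetter.primed k then y k else 1 := by
    intro c
    obtain ⟨⟨k, b⟩, hk⟩ : ∃ p : Fin n × Bool, toLex p = T c := ⟨ofLex (T c), rfl⟩
    rw [← hk]
    cases b <;>
      simp [letterWeight, PrimedLetter.unprimed, PrimedLetter.primed, PrimedLetter.index]
  simp only [h]
  rw [Finset.prod_mul_distrib, Finset.prod_comm, Finset.prod_comm (s := Finset.univ) (t :=
    (Finset.univ : Finset (Fin n))) (f := fun c k => if T c = PrimedLetter.primed k then y k else 1)]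
  simp only [ShiftedFilling.monomial, ShiftedFilling.unprimedCount, ShiftedFilling.primedCount,
    ← Finset.prod_filter, Finset.prod_const]

/-- The numbering of the letters `1' < 1 < 2' < 2 < ⋯` in increasing order. -/
def letterCode (n : ℕ) : PrimedLetter n ≃ Fin (2 * n) where
  toFun a := ⟨2 * a.index + if (ofLex a).2 then 1 else 0, by
    have := a.index.2
    split_ifs <;> omega⟩
  invFun b := toLex (⟨(b : ℕ) / 2, by have := b.2; omega⟩, decide ((b : ℕ) % 2 = 1))
  left_inv a := by
    obtain ⟨⟨k, b⟩, rfl⟩ : ∃ p : Fin n × Bool, toLex p = a := ⟨ofLex a, rfl⟩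
    cases b
    · simp [PrimedLetter.index]
    · have h : (2 * (k : ℕ) + 1) / 2 = k := by omega
      have h' : (2 * (k : ℕ) + 1) % 2 = 1 := by omega
      simp [PrimedLetter.index, h, h']
  right_inv b := by
    apply Fin.ext
    simp only [PrimedLetter.index, ofLex_toLex, decide_eq_true_eq]
    split_ifs <;> omega

theorem letterCode_le_iff {n : ℕ} {a b : PrimedLetter n} :
    letterCode n a ≤ letterCode n b ↔ a ≤ b := by
  obtain ⟨⟨k, u⟩, rfl⟩ : ∃ p : Fin n × Bool, toLex p = a := ⟨ofLex a, rfl⟩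
  obtain ⟨⟨l, v⟩, rfl⟩ : ∃ p : Fin n × Bool, toLex p = b := ⟨ofLex b, rfl⟩
  rw [Prod.Lex.toLex_le_toLex, Fin.le_def]
  simp only [letterCode, PrimedLetter.index, ofLex_toLex, Equiv.coe_fn_mk, Fin.lt_def, Fin.ext_iff]
  cases u <;> cases v <;> simp <;> omega

theorem even_letterCode_iff {n : ℕ} {a : PrimedLetter n} :
    Even (letterCode n a : ℕ) ↔ a.Primed := by
  obtain ⟨⟨k, b⟩, rfl⟩ : ∃ p : Fin n × Bool, toLex p = a := ⟨ofLex a, rfl⟩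
  cases b <;> simp [letterCode, PrimedLetter.Primed]

theorem shiftedWeight_letterCode {R : Type*} [CommRing R] {n : ℕ} (x y : Fin n → R)
    (a : PrimedLetter n) :
    shiftedWeight (extendByZero x) (extendByZero y) (letterCode n a) = letterWeight x y a := by
  obtain ⟨⟨k, b⟩, rfl⟩ : ∃ p : Fin n × Bool, toLex p = a := ⟨ofLex a, rfl⟩
  cases b
  · simpa [letterCode, letterWeight, PrimedLetter.index, shiftedWeight_even] using
      extendByZero_val y k
  · simpa [letterCode, letterWeight, PrimedLetter.index, shiftedWeight_odd] using
      extendByZero_val x k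

/-- A filling by primed letters is a primed shifted tableau if and only if its encoding is a strip
tableau: rows and columns increase, and equal letters lie in different columns or rows. -/
theorem isStripTableau_letterCode_iff {μ : StrictPartition} {n : ℕ} (q : Prop)
    (T : ShiftedFilling μ n) :
    IsStripTableau (shiftedStrip q) (fun c => letterCode n (T c)) ↔
      IsQST T ∧ (q ∨ T.DiagonalUnprimed) := by
  constructor
  · intro h
    have hstrip := fun a => h.strip (letterCode n a)
    refine ⟨⟨fun c d h1 h2 => letterCode_le_iff.1 (h.row_weak c d h1 h2),
      fun c d h1 h2 => letterCode_le_iff.1 (h.col_weak c d h1 h2), ?_, ?_⟩, ?_⟩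
    · intro c d h1 hne heq
      by_contra hp
      have := hstrip (T c)
      rw [shiftedStrip, if_neg fun he => hp (even_letterCode_iff.1 he)] at this
      exact hne (Subtype.ext (this _ (mem_fillingFiber.2 ⟨c.2, rfl⟩) _
        (mem_fillingFiber.2 ⟨d.2, congrArg _ heq.symm⟩) h1))
    · intro c d h1 hne heq hp
      have := hstrip (T c)
      rw [shiftedStrip, if_pos (even_letterCode_iff.2 hp)] at this
      exact hne (Subtype.ext (this.1 _ (mem_fillingFiber.2 ⟨c.2, rfl⟩) _
        (mem_fillingFiber.2 ⟨d.2, congrArg _ heq.symm⟩) h1))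
    · by_cases hq : q
      · exact Or.inl hq
      · refine Or.inr fun c hc hp => ?_
        have := hstrip (T c)
        rw [shiftedStrip, if_pos (even_letterCode_iff.2 hp)] at this
        exact this.2.resolve_left hq _ (mem_fillingFiber.2 ⟨c.2, rfl⟩) hc
  · rintro ⟨h, hq⟩
    refine ⟨fun c d h1 h2 => letterCode_le_iff.2 (h.row_weak c d h1 h2),
      fun c d h1 h2 => letterCode_le_iff.2 (h.col_weak c d h1 h2), fun a => ?_⟩
    obtain ⟨a, rfl⟩ := (letterCode n).surjective a
    have hmem : ∀ {c}, c ∈ fillingFiber (fun c => letterCode n (T c)) (letterCode n a) →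
        ∃ hc, T ⟨c, hc⟩ = a := fun hc =>
      (mem_fillingFiber.1 hc).imp fun _ h => (letterCode n).injective h
    rw [shiftedStrip]
    split_ifs with hp
    · rw [even_letterCode_iff] at hp
      refine ⟨fun c hc d hd h1 => ?_, hq.imp_right fun hq c hc h1 => ?_⟩
      · obtain ⟨hc, hca⟩ := hmem hc
        obtain ⟨hd, hda⟩ := hmem hd
        by_contra hne
        exact h.row_primed ⟨c, hc⟩ ⟨d, hd⟩ h1 (fun h => hne (congrArg Subtype.val h))
          (hca.trans hda.symm) (hca.symm ▸ hp)
      · obtain ⟨hc, hca⟩ := hmem hc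
        exact hq ⟨c, hc⟩ h1 (hca.symm ▸ hp)
    · rw [even_letterCode_iff] at hp
      intro c hc d hd h1
      obtain ⟨hc, hca⟩ := hmem hc
      obtain ⟨hd, hda⟩ := hmem hd
      by_contra hne
      exact hp (hca ▸ h.col_unprimed ⟨c, hc⟩ ⟨d, hd⟩ h1 (fun h => hne (congrArg Subtype.val h))
        (hca.trans hda.symm))

theorem shiftedSum_eq_tableauSum {R : Type*} [CommRing R] {μ : StrictPartition} {n : ℕ}
    (q : Prop) {S : ShiftedFilling μ n → Prop} (hS : ∀ T, S T ↔ IsQST T ∧ (q ∨ T.DiagonalUnprimed))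
    (x y : Fin n → R) :
    shiftedSum S x y = tableauSum (shiftedStrip q)
      (shiftedWeight (extendByZero x) (extendByZero y)) (2 * n) μ.shiftedDiagram := by
  classical
  rw [shiftedSum, tableauSum, Finset.sum_filter, Finset.sum_filter]
  refine Fintype.sum_equiv (Equiv.arrowCongr (Equiv.refl _) (letterCode n)) _ _ fun T => ?_
  have h1 : Equiv.arrowCongr (Equiv.refl _) (letterCode n) T = fun c => letterCode n (T c) := rfl
  rw [h1]
  refine if_congr ((hS T).trans (isStripTableau_letterCode_iff q T).symm) ?_ rfl
  rw [monomial_eq_prod]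
  exact Finset.prod_congr rfl fun c _ => (shiftedWeight_letterCode x y (T c)).symm

/-! ### Numberings of the staircase and the factorisation -/

/-- In a numbering of the staircase counted here the boxes are filled independently: the box
`(i, j)` contains the unprimed letter `i` or the primed letter `j`. -/
theorem shiftedSum_staircase {R : Type*} [CommRing R] {n : ℕ} (q : Prop) [Decidable q]
    {S : ShiftedFilling (staircase n) n → Prop}
    (hS : ∀ T, S T ↔ IsQD T ∧ (q ∨ T.DiagonalUnprimed)) (x y : Fin n → R) :
    shiftedSum S x y = ∏ i ∈ Finset.range n, ∏ j ∈ Finset.Ico i n,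
        (extendByZero x i + if q ∨ i ≠ j then extendByZero y j else 0) := by
  classical
  let good : ℕ × ℕ → PrimedLetter n → Prop := fun c a => (¬ a.Primed → c.1 = a.index) ∧
    (a.Primed → c.2 = a.index) ∧ (q ∨ (c.1 = c.2 → ¬ a.Primed))
  have hgood : Finset.univ.filter S = Fintype.piFinset fun c => Finset.univ.filter (good c.1) := by
    ext T
    simp only [Finset.mem_filter, Finset.mem_univ, true_and, Fintype.mem_piFinset, hS, good]
    constructor
    · exact fun h c => ⟨h.1.unprimed_row c, h.1.primed_col c, h.2.imp_right fun h => h c⟩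
    · intro h
      refine ⟨⟨fun c => (h c).1, fun c => (h c).2.1⟩, ?_⟩
      by_cases hq : q
      · exact Or.inl hq
      · exact Or.inr fun c => (h c).2.2.resolve_left hq
  have hsum : ∀ i j, i < n → j < n → ∑ a with good (i, j) a, letterWeight x y a =
      extendByZero x i + if q ∨ i ≠ j then extendByZero y j else 0 := by
    intro i j hi hj
    rw [Finset.sum_filter, ← (toLex : Fin n × Bool ≃ _).sum_comp, Fintype.sum_prod_type]
    simp only [Fintype.sum_bool, good, letterWeight, PrimedLetter.Primed, PrimedLetter.index,
      ofLex_toLex]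
    rw [Finset.sum_add_distrib]
    congr 1
    · rw [Finset.sum_eq_single (⟨i, hi⟩ : Fin n)]
      · simp [extendByZero, hi]
      · intro k _ hk
        rw [if_neg]
        rintro ⟨h, -⟩
        exact hk (Fin.ext (h (by simp)).symm)
      · simp
    · rw [Finset.sum_eq_single (⟨j, hj⟩ : Fin n)]
      · simp [extendByZero, hj]
      · intro k _ hk
        rw [if_neg]
        rintro ⟨-, h, -⟩
        exact hk (Fin.ext (h (by simp)).symm)
      · simp
  rw [shiftedSum, hgood]
  simp only [monomial_eq_prod]
  refine (Finset.prod_univ_sum (fun c : {c // c ∈ (staircase n).shiftedDiagram} =>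
    Finset.univ.filter (good c.1)) fun _ a => letterWeight x y a).symm.trans ?_
  rw [Finset.prod_coe_sort (staircase n).shiftedDiagram
      fun c => ∑ a with good c a, letterWeight x y a, shiftedDiagram_staircase, rowDiagram,
    Finset.prod_biUnion, Finset.prod_range]
  · refine Finset.prod_congr rfl fun i _ => ?_
    rw [Finset.prod_map]
    exact Finset.prod_congr rfl fun j hj => hsum i j i.2 (Finset.mem_Ico.1 hj).2
  · intro i _ k _ hik
    rw [Function.onFun, Finset.disjoint_left]
    intro c hc hc'
    simp only [Finset.mem_map, Function.Embedding.coeFn_mk] at hc hc'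
    obtain ⟨j, _, rfl⟩ := hc
    obtain ⟨j', _, h⟩ := hc'
    exact hik (Fin.ext (Prod.mk.inj h).1.symm)

theorem shiftedSum_addStaircase {R : Type*} [CommRing R] {n : ℕ} {lam : YoungDiagram}
    (hlam : lam.colLen 0 ≤ n) (q : Prop) [Decidable q]
    {S : ShiftedFilling (addStaircase lam n) n → Prop}
    (hS : ∀ T, S T ↔ IsQST T ∧ (q ∨ T.DiagonalUnprimed)) (x y : Fin n → R) :
    shiftedSum S x y = schurS lam x * ∏ i ∈ Finset.range n, ∏ j ∈ Finset.Ico i n,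
        (extendByZero x i + if q ∨ i ≠ j then extendByZero y j else 0) := by
  rw [shiftedSum_eq_tableauSum q hS, shiftedDiagram_addStaircase, schurS_eq_tableauSum,
    youngDiagram_cells_eq hlam, ← prod_range_eq,
    tableauSum_shiftedStrip_eq q _ _ fun i k hik => lam.rowLen_anti i k hik]

theorem mainTheorem2 {R : Type*} [CommRing R] (n : ℕ) (lam : YoungDiagram)
    (hlam : lam.colLen 0 ≤ n) (x y : Fin n → R) :
    schurP (addStaircase lam n) x y =
        schurS lam x * (∏ i, x i) * ∏ i, ∏ j ∈ Finset.Ioi i, (x i + y j) ∧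
      schurQ (addStaircase lam n) x y =
        schurS lam x * ∏ i, ∏ j ∈ Finset.Ici i, (x i + y j) ∧
      schurP (addStaircase lam n) x y = shiftedSum IsPD x y * schurS lam x ∧
      schurQ (addStaircase lam n) x y = shiftedSum IsQD x y * schurS lam x := by
  have hP : schurP (addStaircase lam n) x y = _ := shiftedSum_addStaircase hlam False
    (fun T => ⟨fun h => ⟨h.toIsQST, Or.inr h.diagonal⟩, fun h => ⟨h.1, h.2.resolve_left id⟩⟩) x y
  have hQ : schurQ (addStaircase lam n) x y = _ := shiftedSum_addStaircase hlam True
    (fun T => ⟨fun h => ⟨h, Or.inl trivial⟩, fun h => h.1⟩) x y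
  have hPD : shiftedSum IsPD x y = _ := shiftedSum_staircase False
    (fun T => ⟨fun h => ⟨h.toIsQD, Or.inr h.diagonal⟩, fun h => ⟨h.1, h.2.resolve_left id⟩⟩) x y
  have hQD : shiftedSum IsQD x y = _ := shiftedSum_staircase True
    (fun T => ⟨fun h => ⟨h, Or.inl trivial⟩, fun h => h.1⟩) x y
  refine ⟨?_, ?_, ?_, ?_⟩
  · rw [hP, prod_Ico_extendByZero, mul_assoc, ← Finset.prod_mul_distrib]
    congr 1
    refine Finset.prod_congr rfl fun i _ => ?_
    rw [Finset.Ici_eq_cons_Ioi, Finset.prod_cons]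
    congr 1
    · simp
    · refine Finset.prod_congr rfl fun j hj => ?_
      rw [if_pos (Or.inr (Finset.mem_Ioi.1 hj).ne)]
  · rw [hQ, prod_Ico_extendByZero]
    simp
  · rw [hP, hPD, mul_comm]
  · rw [hQ, hQD, mul_comm]
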